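/- Let $d\ge 1$ and let $J:\mathbb Z^d\to\mathbb R$ satisfy $J(-x)=J(x)$ and $\sum_{x}|J(x)|<\infty$. Let $\beta>0$, and consider the Ising-type model with spins $\sigma_x\in\{-1,+1\}$ and formal Hamiltonian $H=-\sum_{x,y\in\mathbb Z^d}J(x-y)\sigma_x\sigma_y$. Assume that it has a unique Gibbs measure $\mu$ at inverse temperature $\beta$, that is, exactly one probability measure on $\{-1,+1\}^{\mathbb Z^d}$ satisfies the DLR equations. Write $\langle\cdot\rangle$ for the expectation with respect to $\mu$, $\|\cdot\|$ for the Euclidean norm, and $n_x=\frac12(\sigma_x+1)$ for the occupation numbers of the associated lattice gas. Assume that one of the following holds: (a) there are $C,\varepsilon>0$ with $|\langle\sigma_0\sigma_x\rangle|\le C e^{-\varepsilon\|x\|}$ for all $x\in\mathbb Z^d$; (b) there are $C>0$ and a real $p>d$ with $|\langle\sigma_0\sigma_x\rangle|\le C\|x\|^{-p}$ for all $x\in\mathbb Z^d\setminus\{0\}$. For a configuration $\sigma$ put $\omega_\sigma=\sum_{x\in\mathbb Z^d}n_x\delta_x$. Its autocorrelation is the vague limit, as $r\to\infty$, of $\mathrm{vol}(B_r)^{-1}\,\omega_{\sigma,r}*\widetilde{\omega_{\sigma,r}}$,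 where $B_r$ is the open ball of radius $r$ about $0$ in $\mathbb R^d$, $\omega_{\sigma,r}$ is the restriction of $\omega_\sigma$ to $B_r$, and $\widetilde{\ \cdot\ }$ denotes the image under $x\mapsto -x$. Its diffraction spectrum is the Fourier transform of the autocorrelation as a tempered distribution (with kernel $e^{-2\pi i\langle k,x\rangle}$), required to be a positive measure. Then for $\mu$-almost every $\sigma$ the autocorrelation of $\omega_\sigma$ exists and equals $\gamma=\sum_{x\in\mathbb Z^d}\langle n_0n_x\rangle\,\delta_x$, and the diffraction spectrum $\hat\gamma$ exists as a positive measure. The measure $\hat\gamma$ is $\mathbb Z^d$-periodic. In its Lebesgue decomposition, the pure point part is $\frac14\,\delta_{\mathbb Z^d}=\frac14\sum_{k\in\mathbb Z^d}\delta_k$, the absolutely continuous part has a continuous density with respect to Lebesgue measure, and the singular continuous part is zero. -/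

import Mathlib

open MeasureTheory Filter Topology
open scoped FourierTransform SchwartzMap ENNReal

noncomputable section

/-- Sites of the integer lattice `ℤ^d`. -/
abbrev Site (d : ℕ) : Type := Fin d → ℤ

/-- Spin configurations `σ ∈ {-1,+1}^(ℤ^d)`, with the product σ-algebra. -/
abbrev SpinConfig (d : ℕ) : Type := Site d → ℤˣ

/-- Euclidean space `ℝ^d`. -/
abbrev RSpace (d : ℕ) : Type := EuclideanSpace ℝ (Fin d)

/-- The inclusion of `ℤ^d` into `ℝ^d`. -/
def sitePoint {d : ℕ} (x : Site d) : RSpace d := WithLp.toLp 2 fun i => (x i : ℝ)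

/-- The spin at the site `x`, as a real number. -/
def spin {d : ℕ} (σ : SpinConfig d) (x : Site d) : ℝ := ((σ x : ℤ) : ℝ)

/-- The occupation number `n_x = (σ_x + 1) / 2` at the site `x`. -/
def occupation {d : ℕ} (σ : SpinConfig d) (x : Site d) : ℝ := (spin σ x + 1) / 2

/-! ### Gibbs measures of the pair potential `J` -/

/-- The terms of the formal Hamiltonian `H = -∑_{x,y} J(x-y) σ_x σ_y` (sum over ordered pairs)
in which at least one of the two sites lies in the finite set `Λ`. -/
def localHamiltonian {d : ℕ} (J : Site d → ℝ) (Λ : Finset (Site d)) (σ : SpinConfig d) : ℝ :=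
  -(∑ x ∈ Λ, ∑ y ∈ Λ, J (x - y) * spin σ x * spin σ y)
    - ∑ x ∈ Λ, ∑' y : {y : Site d // y ∉ Λ},
        (J (x - y) + J (y - x)) * spin σ x * spin σ y

/-- The configuration that is `ζ` inside `Λ` and `ω` outside `Λ`. -/
def glue {d : ℕ} (Λ : Finset (Site d)) (ζ : Λ → ℤˣ) (ω : SpinConfig d) : SpinConfig d :=
  fun x => if h : x ∈ Λ then ζ ⟨x, h⟩ else ω x

/-- The partition function in the finite volume `Λ` with boundary condition `ω`. -/
def partitionFunction {d : ℕ} (J : Site d → ℝ) (β : ℝ) (Λ : Finset (Site d))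
    (ω : SpinConfig d) : ℝ :=
  ∑ ζ : Λ → ℤˣ, Real.exp (-β * localHamiltonian J Λ (glue Λ ζ ω))

/-- The finite-volume Gibbs distribution in `Λ` with boundary condition `ω`. -/
def gibbsDistribution {d : ℕ} (J : Site d → ℝ) (β : ℝ) (Λ : Finset (Site d))
    (ω : SpinConfig d) : Measure (SpinConfig d) :=
  ∑ ζ : Λ → ℤˣ,
    ENNReal.ofReal (Real.exp (-β * localHamiltonian J Λ (glue Λ ζ ω)) /
      partitionFunction J β Λ ω) • Measure.dirac (glue Λ ζ ω)

/-- Infinite-volume Gibbs measures at inverse temperature `β`: probability measures satisfying the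
Dobrushin-Lanford-Ruelle equations for all finite volumes. -/
structure IsGibbsMeasure {d : ℕ} (J : Site d → ℝ) (β : ℝ) (μ : Measure (SpinConfig d)) :
    Prop where
  isProbabilityMeasure : IsProbabilityMeasure μ
  dlr : ∀ (Λ : Finset (Site d)) (A : Set (SpinConfig d)), MeasurableSet A →
    ∫⁻ ω, gibbsDistribution J β Λ ω A ∂μ = μ A

/-- The spin correlation coefficient `⟨σ_0 σ_x⟩`. -/
def spinCorrelation {d : ℕ} (μ : Measure (SpinConfig d)) (x : Site d) : ℝ :=
  ∫ σ, spin σ 0 * spin σ x ∂μ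

/-- The density-density correlation `⟨n_0 n_x⟩`. -/
def densityCorrelation {d : ℕ} (μ : Measure (SpinConfig d)) (x : Site d) : ℝ :=
  ∫ σ, occupation σ 0 * occupation σ x ∂μ

/-! ### Diffraction -/

/-- The Dirac comb `∑_x n_x δ_x` of the particles of the lattice gas. -/
def particleMeasure {d : ℕ} (σ : SpinConfig d) : Measure (RSpace d) :=
  Measure.sum fun x : Site d =>
    ENNReal.ofReal (occupation σ x) • Measure.dirac (sitePoint x)

/-- The measure `∑_x ⟨n_0 n_x⟩ δ_x`. -/
def correlationMeasure {d : ℕ} (μ : Measure (SpinConfig d)) : Measure (RSpace d) :=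
  Measure.sum fun x : Site d =>
    ENNReal.ofReal (densityCorrelation μ x) • Measure.dirac (sitePoint x)

/-- The uniform Dirac comb `δ_{ℤ^d}`. -/
def latticeComb (d : ℕ) : Measure (RSpace d) :=
  Measure.sum fun k : Site d => Measure.dirac (sitePoint k)

/-- `vol(B_r)⁻¹ (ω_r ∗ ω̃_r)`, where `ω_r` is the restriction of `ω` to the ball `B_r` of radius `r`
about the origin and `ω̃_r` is the image of `ω_r` under `x ↦ -x`. -/
def finiteAutocorrelation {d : ℕ} (ω : Measure (RSpace d)) (r : ℝ) : Measure (RSpace d) :=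
  (volume (Metric.ball (0 : RSpace d) r))⁻¹ •
    Measure.conv (ω.restrict (Metric.ball 0 r))
      ((ω.restrict (Metric.ball 0 r)).map fun x => -x)

/-- `γ` is the (natural) autocorrelation of `ω`: a locally finite measure that is the limit of
the finite autocorrelations in the vague topology. -/
structure IsAutocorrelation {d : ℕ} (ω γ : Measure (RSpace d)) : Prop where
  isLocallyFinite : IsLocallyFiniteMeasure γ
  tendsto : ∀ f : RSpace d → ℝ, Continuous f → HasCompactSupport f →
    Tendsto (fun r : ℝ => ∫ x, f x ∂(finiteAutocorrelation ω r)) atTop (𝓝 (∫ x, f x ∂γ))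

/-- The positive measure `ν` is the Fourier transform, in the sense of tempered distributions, of
the positive measure `γ`. -/
structure IsFourierTransformOf {d : ℕ} (γ ν : Measure (RSpace d)) : Prop where
  integrable_left : ∀ φ : 𝓢(RSpace d, ℂ), Integrable (φ : RSpace d → ℂ) γ
  integrable_right : ∀ φ : 𝓢(RSpace d, ℂ), Integrable (φ : RSpace d → ℂ) ν
  integral_eq : ∀ φ : 𝓢(RSpace d, ℂ),
    ∫ k, φ k ∂ν = ∫ x, 𝓕 (φ : RSpace d → ℂ) x ∂γ

/-- `ν` is the diffraction spectrum of `ω`: the Fourier transform of its autocorrelation. -/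
def IsDiffractionSpectrum {d : ℕ} (ω ν : Measure (RSpace d)) : Prop :=
  ∃ γ : Measure (RSpace d), IsAutocorrelation ω γ ∧ IsFourierTransformOf γ ν

/-- `ν` is invariant under translation by the vectors of `ℤ^d`. -/
def IsLatticePeriodic {d : ℕ} (ν : Measure (RSpace d)) : Prop :=
  ∀ k : Site d, ν.map (fun x => x + sitePoint k) = ν

/-- `pp`, `ac`, `sc` are the pure point, the absolutely continuous and the singular continuous
part of `ν` with respect to Lebesgue measure. -/
structure IsLebesgueDecomposition {d : ℕ} (ν pp ac sc : Measure (RSpace d)) : Prop where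
  eq_add : ν = pp + ac + sc
  purePoint : ∃ S : Set (RSpace d), S.Countable ∧ pp Sᶜ = 0
  absolutelyContinuous : ac ≪ volume
  sc_noAtoms : ∀ x, sc {x} = 0
  sc_singular : sc ⟂ₘ volume

end

/-!
The diffraction spectrum of the Ising lattice gas in a phase with a unique Gibbs measure.

*Autocorrelation.* The only ergodic input that is needed is supplied by the uniqueness of the Gibbs
measure, without any general ergodic theorem. A density that depends on the spins outside a volume
`Λ` preserves the DLR equations for the subvolumes of `Λ`. Hence, by compactness of the space of
probability measures and the Feller property of the specification, any failure of uniform mixing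
would produce a second Gibbs measure (`exists_finset_abs_integral_mul_sub_le`). Uniform mixing
bounds the exponential moments of sums of sparse translates of a local observable
(`integral_exp_sum_shift_le`), which gives exponentially small large-deviation probabilities for
sums over arbitrary finite sets of translates (`exists_measure_sum_shift_le`). Squared norms of
lattice points are integers, so the balls cut out only a sequence of sets of sites, and
Borel-Cantelli yields the almost sure convergence of the pair averages along all real radii
(`ae_tendsto_average_shift`, `ae_tendsto_pairSites_average`). The finite autocorrelations are
combinations of these averages (`integral_finiteAutocorrelation`, `sum_ballSites_sub`).

*Diffraction.* Uniqueness also forces invariance of `μ` under translations and under the global spin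
flip, so that `⟨n_0 n_x⟩ = (1 + ⟨σ_0 σ_x⟩) / 4`. The constant part is transformed by the Poisson
summation formula (`hasSum_fourier_sitePoint`), and gives the pure point part. The correlations
`⟨σ_0 σ_x⟩` are summable by either decay hypothesis, so their transform is a uniformly convergent
cosine series. Its nonnegativity holds because it is the limit of finite-volume structure
factors (`diffractionDensity_nonneg`).
-/

/-! ### Spins and the specification -/

instance : DiscreteMeasurableSpace ℤˣ where
  forall_measurableSet s := ⟨Units.val '' s, trivial, Set.preimage_image_eq s Units.val_injective⟩

instance : BorelSpace ℤˣ where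
  measurable_eq := by
    rw [borel_eq_top_of_discrete]
    exact top_unique fun s _ => MeasurableSet.of_discrete

lemma continuous_spin {d : ℕ} (x : Site d) : Continuous fun σ : SpinConfig d => spin σ x := by
  have : Continuous fun u : ℤˣ => ((u : ℤ) : ℝ) := continuous_of_discreteTopology
  exact this.comp (continuous_apply x)

lemma abs_spin {d : ℕ} (σ : SpinConfig d) (x : Site d) : |spin σ x| = 1 := by
  rcases Int.units_eq_one_or (σ x) with h | h <;> simp [spin, h]

lemma occupation_mem_Icc {d : ℕ} (σ : SpinConfig d) (x : Site d) :
    occupation σ x ∈ Set.Icc (0 : ℝ) 1 := by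
  have := abs_le.1 (abs_spin σ x).le
  constructor <;> unfold occupation <;> linarith [this.1, this.2]

lemma continuous_occupation {d : ℕ} (x : Site d) :
    Continuous fun σ : SpinConfig d => occupation σ x :=
  ((continuous_spin x).add continuous_const).div_const 2

lemma continuous_glue {d : ℕ} (Λ : Finset (Site d)) (ζ : Λ → ℤˣ) :
    Continuous fun ω : SpinConfig d => glue Λ ζ ω := by
  refine continuous_pi fun x => ?_
  by_cases h : x ∈ Λ
  · simpa [glue, h] using continuous_const
  · simpa [glue, h] using continuous_apply x

lemma glue_of_notMem {d : ℕ} {Λ : Finset (Site d)} (ζ : Λ → ℤˣ) (ω : SpinConfig d) {x : Site d}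
    (h : x ∉ Λ) : glue Λ ζ ω x = ω x := by
  simp [glue, h]

/-- The interaction between the volume `Λ` and its complement, written as a sum over the whole
lattice. -/
lemma localHamiltonian_eq_tsum {d : ℕ} (J : Site d → ℝ) (Λ : Finset (Site d))
    (σ : SpinConfig d) :
    localHamiltonian J Λ σ = -(∑ x ∈ Λ, ∑ y ∈ Λ, J (x - y) * spin σ x * spin σ y)
      - ∑ x ∈ Λ, ∑' y : Site d, if y ∈ Λ then 0 else
        (J (x - y) + J (y - x)) * spin σ x * spin σ y := by
  unfold localHamiltonian
  congr 1
  refine Finset.sum_congr rfl fun x _ => ?_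
  refine (tsum_subtype {y : Site d | y ∉ Λ}
    fun y => (J (x - y) + J (y - x)) * spin σ x * spin σ y).trans ?_
  refine tsum_congr fun y => ?_
  by_cases h : y ∈ Λ <;> simp [h]

lemma continuous_localHamiltonian {d : ℕ} {J : Site d → ℝ} (hJ : Summable fun x => |J x|)
    (Λ : Finset (Site d)) : Continuous fun σ : SpinConfig d => localHamiltonian J Λ σ := by
  simp_rw [localHamiltonian_eq_tsum]
  refine (Continuous.neg ?_).sub ?_
  · exact continuous_finsetSum _ fun x _ => continuous_finsetSum _ fun y _ =>
      (continuous_const.mul (continuous_spin x)).mul (continuous_spin y)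
  · refine continuous_finsetSum _ fun x _ => ?_
    refine continuous_tsum (u := fun y => |J (x - y)| + |J (y - x)|) (fun y => ?_) ?_ ?_
    · split_ifs
      · exact continuous_const
      · exact (continuous_const.mul (continuous_spin x)).mul (continuous_spin y)
    · exact ((Equiv.subLeft x).summable_iff.2 hJ).add ((Equiv.subRight x).summable_iff.2 hJ)
    · intro y σ
      split_ifs
      · simpa using by positivity
      · rw [Real.norm_eq_abs, abs_mul, abs_mul, abs_spin, abs_spin, mul_one, mul_one]
        exact abs_add_le _ _

/-- The probability of the configuration `ζ` in the volume `Λ` under the boundary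
condition `ω`. -/
noncomputable def gibbsWeight {d : ℕ} (J : Site d → ℝ) (β : ℝ) (Λ : Finset (Site d))
    (ζ : Λ → ℤˣ) (ω : SpinConfig d) : ℝ :=
  Real.exp (-β * localHamiltonian J Λ (glue Λ ζ ω)) / partitionFunction J β Λ ω

lemma partitionFunction_pos {d : ℕ} (J : Site d → ℝ) (β : ℝ) (Λ : Finset (Site d))
    (ω : SpinConfig d) : 0 < partitionFunction J β Λ ω :=
  Finset.sum_pos (fun _ _ => Real.exp_pos _) Finset.univ_nonempty

lemma gibbsWeight_nonneg {d : ℕ} (J : Site d → ℝ) (β : ℝ) (Λ : Finset (Site d))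
    (ζ : Λ → ℤˣ) (ω : SpinConfig d) : 0 ≤ gibbsWeight J β Λ ζ ω :=
  div_nonneg (Real.exp_pos _).le (partitionFunction_pos J β Λ ω).le

lemma sum_gibbsWeight {d : ℕ} (J : Site d → ℝ) (β : ℝ) (Λ : Finset (Site d))
    (ω : SpinConfig d) : ∑ ζ, gibbsWeight J β Λ ζ ω = 1 := by
  unfold gibbsWeight
  rw [← Finset.sum_div]
  exact div_self (partitionFunction_pos J β Λ ω).ne'

lemma continuous_gibbsWeight {d : ℕ} {J : Site d → ℝ} (hJ : Summable fun x => |J x|) (β : ℝ)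
    (Λ : Finset (Site d)) (ζ : Λ → ℤˣ) : Continuous (gibbsWeight J β Λ ζ) := by
  have h (ζ : Λ → ℤˣ) : Continuous fun ω : SpinConfig d =>
      Real.exp (-β * localHamiltonian J Λ (glue Λ ζ ω)) :=
    Real.continuous_exp.comp (continuous_const.mul
      ((continuous_localHamiltonian hJ Λ).comp (continuous_glue Λ ζ)))
  exact (h ζ).div (continuous_finsetSum _ fun ζ _ => h ζ)
    fun ω => (partitionFunction_pos J β Λ ω).ne'

lemma gibbsDistribution_eq {d : ℕ} (J : Site d → ℝ) (β : ℝ) (Λ : Finset (Site d))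
    (ω : SpinConfig d) : gibbsDistribution J β Λ ω =
      ∑ ζ, ENNReal.ofReal (gibbsWeight J β Λ ζ ω) • Measure.dirac (glue Λ ζ ω) := rfl

lemma lintegral_gibbsDistribution {d : ℕ} (J : Site d → ℝ) (β : ℝ) (Λ : Finset (Site d))
    (ω : SpinConfig d) {f : SpinConfig d → ℝ≥0∞} (hf : Measurable f) :
    ∫⁻ σ, f σ ∂gibbsDistribution J β Λ ω =
      ∑ ζ, ENNReal.ofReal (gibbsWeight J β Λ ζ ω) * f (glue Λ ζ ω) := by
  rw [gibbsDistribution_eq, lintegral_finsetSum_measure]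
  refine Finset.sum_congr rfl fun ζ _ => ?_
  rw [lintegral_smul_measure, lintegral_dirac' _ hf, smul_eq_mul]

lemma gibbsDistribution_apply {d : ℕ} (J : Site d → ℝ) (β : ℝ) (Λ : Finset (Site d))
    (ω : SpinConfig d) {A : Set (SpinConfig d)} (hA : MeasurableSet A) :
    gibbsDistribution J β Λ ω A =
      ∑ ζ, ENNReal.ofReal (gibbsWeight J β Λ ζ ω) * A.indicator 1 (glue Λ ζ ω) := by
  rw [← lintegral_gibbsDistribution J β Λ ω (measurable_one.indicator hA),
    lintegral_indicator_one hA]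

instance {d : ℕ} (J : Site d → ℝ) (β : ℝ) (Λ : Finset (Site d)) (ω : SpinConfig d) :
    IsProbabilityMeasure (gibbsDistribution J β Λ ω) where
  measure_univ := by
    rw [gibbsDistribution_apply _ _ _ _ MeasurableSet.univ]
    simp only [Set.indicator_univ, Pi.one_apply, mul_one]
    rw [← ENNReal.ofReal_sum_of_nonneg fun ζ _ => gibbsWeight_nonneg J β Λ ζ ω,
      sum_gibbsWeight, ENNReal.ofReal_one]

lemma integral_gibbsDistribution {d : ℕ} (J : Site d → ℝ) (β : ℝ) (Λ : Finset (Site d))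
    (ω : SpinConfig d) {f : SpinConfig d → ℝ} (hf : Continuous f) :
    ∫ σ, f σ ∂gibbsDistribution J β Λ ω =
      ∑ ζ, gibbsWeight J β Λ ζ ω * f (glue Λ ζ ω) := by
  rw [gibbsDistribution_eq, integral_finsetSum_measure]
  · refine Finset.sum_congr rfl fun ζ _ => ?_
    rw [integral_smul_measure, integral_dirac' _ _ hf.stronglyMeasurable, smul_eq_mul,
      ENNReal.toReal_ofReal (gibbsWeight_nonneg J β Λ ζ ω)]
  · intro ζ _
    exact (integrable_dirac' hf.stronglyMeasurable (by simp)).smul_measure ENNReal.ofReal_ne_top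

lemma measurable_gibbsDistribution {d : ℕ} {J : Site d → ℝ} (hJ : Summable fun x => |J x|)
    (β : ℝ) (Λ : Finset (Site d)) : Measurable (gibbsDistribution J β Λ) := by
  refine Measure.measurable_of_measurable_coe _ fun A hA => ?_
  simp_rw [gibbsDistribution_apply J β Λ _ hA]
  refine Finset.measurable_fun_sum _ fun ζ _ => ?_
  exact ((continuous_gibbsWeight hJ β Λ ζ).measurable.ennreal_ofReal).mul
    ((measurable_one.indicator hA).comp (continuous_glue Λ ζ).measurable)

/-- The DLR equation in the form `μ π_Λ = μ`. -/
lemma bind_gibbsDistribution_eq_iff {d : ℕ} {J : Site d → ℝ} (hJ : Summable fun x => |J x|)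
    {β : ℝ} {Λ : Finset (Site d)} {μ : Measure (SpinConfig d)} :
    μ.bind (gibbsDistribution J β Λ) = μ ↔
      ∀ A, MeasurableSet A → ∫⁻ ω, gibbsDistribution J β Λ ω A ∂μ = μ A := by
  have h := (measurable_gibbsDistribution hJ β Λ).aemeasurable (μ := μ)
  refine ⟨fun H A hA => ?_, fun H => Measure.ext fun A hA => ?_⟩
  · rw [← Measure.bind_apply hA h, H]
  · rw [Measure.bind_apply hA h, H A hA]

/-- The Feller property of the specification: averaging with respect to the finite-volume Gibbs
distribution preserves continuity, because the potential is summable. -/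
lemma continuous_integral_gibbsDistribution {d : ℕ} {J : Site d → ℝ}
    (hJ : Summable fun x => |J x|) (β : ℝ) (Λ : Finset (Site d)) {f : SpinConfig d → ℝ}
    (hf : Continuous f) : Continuous fun ω => ∫ σ, f σ ∂gibbsDistribution J β Λ ω := by
  simp_rw [integral_gibbsDistribution J β Λ _ hf]
  exact continuous_finsetSum _ fun ζ _ =>
    (continuous_gibbsWeight hJ β Λ ζ).mul (hf.comp (continuous_glue Λ ζ))

lemma integrable_of_continuous {d : ℕ} {μ : Measure (SpinConfig d)} [IsFiniteMeasure μ]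
    {f : SpinConfig d → ℝ} (hf : Continuous f) : Integrable f μ :=
  hf.integrable_of_hasCompactSupport (HasCompactSupport.of_compactSpace f)

/-- A density which only depends on the spins outside `Λ` preserves the DLR equation
for `Λ`. -/
lemma bind_gibbsDistribution_withDensity {d : ℕ} {J : Site d → ℝ}
    (hJ : Summable fun x => |J x|) {β : ℝ} {Λ : Finset (Site d)} {μ : Measure (SpinConfig d)}
    (hμ : μ.bind (gibbsDistribution J β Λ) = μ) {g : SpinConfig d → ℝ≥0∞} (hg : Measurable g)
    (hgΛ : DependsOn g (Λ : Set (Site d))ᶜ) :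
    (μ.withDensity g).bind (gibbsDistribution J β Λ) = μ.withDensity g := by
  have hK := measurable_gibbsDistribution hJ β Λ
  refine (bind_gibbsDistribution_eq_iff hJ).2 fun A hA => ?_
  have hm : Measurable fun ω => gibbsDistribution J β Λ ω A := (Measure.measurable_coe hA).comp hK
  have hf : Measurable fun σ => g σ * A.indicator 1 σ := hg.mul (measurable_one.indicator hA)
  calc ∫⁻ ω, gibbsDistribution J β Λ ω A ∂μ.withDensity g
      = ∫⁻ ω, g ω * gibbsDistribution J β Λ ω A ∂μ :=
        lintegral_withDensity_eq_lintegral_mul _ hg hm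
    _ = ∫⁻ ω, ∫⁻ σ, g σ * A.indicator 1 σ ∂gibbsDistribution J β Λ ω ∂μ := by
        refine lintegral_congr fun ω => ?_
        rw [lintegral_gibbsDistribution _ _ _ _ hf, gibbsDistribution_apply _ _ _ _ hA,
          Finset.mul_sum]
        refine Finset.sum_congr rfl fun ζ _ => ?_
        rw [hgΛ (x := glue Λ ζ ω) (y := ω) fun x hx => glue_of_notMem ζ ω hx]
        ring
    _ = ∫⁻ σ, g σ * A.indicator 1 σ ∂μ := by
        rw [← Measure.lintegral_bind hK.aemeasurable hf.aemeasurable, hμ]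
    _ = μ.withDensity g A := by
        rw [withDensity_apply _ hA, ← lintegral_indicator hA]
        refine lintegral_congr fun σ => ?_
        by_cases h : σ ∈ A <;> simp [h]

/-! ### Symmetries of the Gibbs measure -/

/-- A transformation of the configuration space under which the local Hamiltonians are
covariant maps Gibbs measures to Gibbs measures. -/
lemma IsGibbsMeasure.map {d : ℕ} {J : Site d → ℝ} (hJ : Summable fun x => |J x|) {β : ℝ}
    {μ : Measure (SpinConfig d)} (hμ : IsGibbsMeasure J β μ) {T : SpinConfig d → SpinConfig d}
    (hT : Measurable T)
    (hsymm : ∀ Λ : Finset (Site d), ∃ (Λ' : Finset (Site d)) (e : (Λ' → ℤˣ) ≃ (Λ → ℤˣ)),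
      (∀ ζ ω, T (glue Λ' ζ ω) = glue Λ (e ζ) (T ω)) ∧
        ∀ σ, localHamiltonian J Λ (T σ) = localHamiltonian J Λ' σ) :
    IsGibbsMeasure J β (μ.map T) := by
  have := hμ.isProbabilityMeasure
  refine ⟨Measure.isProbabilityMeasure_map hT.aemeasurable, fun Λ A hA => ?_⟩
  obtain ⟨Λ', e, he, hH⟩ := hsymm Λ
  have hZ (ω : SpinConfig d) : partitionFunction J β Λ (T ω) = partitionFunction J β Λ' ω := by
    unfold partitionFunction
    rw [← e.sum_comp]
    simp_rw [← he, hH]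
  have hm : Measurable fun ω => gibbsDistribution J β Λ ω A :=
    (Measure.measurable_coe hA).comp (measurable_gibbsDistribution hJ β Λ)
  rw [lintegral_map hm hT,
    Measure.map_apply hT hA, ← hμ.dlr Λ' _ (hT hA)]
  refine lintegral_congr fun ω => ?_
  rw [gibbsDistribution_apply _ _ _ _ hA, gibbsDistribution_apply _ _ _ _ (hT hA), ← e.sum_comp]
  refine Finset.sum_congr rfl fun ζ _ => ?_
  simp only [gibbsWeight, hZ, ← he, hH]
  rfl

/-- The translation of spin configurations by the lattice vector `a`. -/
def shift {d : ℕ} (a : Site d) (σ : SpinConfig d) : SpinConfig d := fun x => σ (x + a)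

lemma continuous_shift {d : ℕ} (a : Site d) : Continuous (shift a) :=
  continuous_pi fun x => continuous_apply (x + a)

@[simp] lemma spin_shift {d : ℕ} (a : Site d) (σ : SpinConfig d) (x : Site d) :
    spin (shift a σ) x = spin σ (x + a) := rfl

@[simp] lemma occupation_shift {d : ℕ} (a : Site d) (σ : SpinConfig d) (x : Site d) :
    occupation (shift a σ) x = occupation σ (x + a) := rfl

lemma shift_neg_shift {d : ℕ} (a : Site d) (σ : SpinConfig d) : shift (-a) (shift a σ) = σ := by
  funext x; simp [shift]

lemma localHamiltonian_shift {d : ℕ} (J : Site d → ℝ) (Λ : Finset (Site d)) (a : Site d)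
    (σ : SpinConfig d) : localHamiltonian J Λ (shift a σ) =
      localHamiltonian J (Λ.map (Equiv.addRight a).toEmbedding) σ := by
  simp only [localHamiltonian_eq_tsum, Finset.sum_map, spin_shift, Equiv.coe_toEmbedding,
    Equiv.coe_addRight, add_sub_add_right_eq_sub]
  congr 1
  refine Finset.sum_congr rfl fun x _ => ?_
  rw [← (Equiv.addRight a).tsum_eq
    (fun y => if y ∈ Λ.map (Equiv.addRight a).toEmbedding then _ else _)]
  refine tsum_congr fun y => ?_
  simp

lemma IsGibbsMeasure.map_shift {d : ℕ} {J : Site d → ℝ} (hJ : Summable fun x => |J x|) {β : ℝ}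
    {μ : Measure (SpinConfig d)} (hμ : IsGibbsMeasure J β μ) (a : Site d) :
    IsGibbsMeasure J β (μ.map (shift a)) := by
  refine hμ.map hJ (continuous_shift a).measurable fun Λ =>
    ⟨Λ.map (Equiv.addRight a).toEmbedding,
      (Equiv.arrowCongr ((Equiv.addRight a).subtypeEquiv (by simp)) (Equiv.refl _)).symm,
      fun ζ ω => ?_, localHamiltonian_shift J Λ a⟩
  funext x
  by_cases h : x ∈ Λ
  · have h' : x + a ∈ Λ.map (Equiv.addRight a).toEmbedding := by simpa using h
    simp only [shift, glue, h', h, dite_true]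
    rfl
  · have h' : x + a ∉ Λ.map (Equiv.addRight a).toEmbedding := by simpa using h
    simp only [shift, glue, h', h, dite_false]

lemma IsGibbsMeasure.map_neg {d : ℕ} {J : Site d → ℝ} (hJ : Summable fun x => |J x|) {β : ℝ}
    {μ : Measure (SpinConfig d)} (hμ : IsGibbsMeasure J β μ) :
    IsGibbsMeasure J β (μ.map fun σ x => -σ x) := by
  refine hμ.map hJ (measurable_pi_lambda _ fun x => ?_) fun Λ =>
    ⟨Λ, Equiv.neg _, fun ζ ω => ?_, fun σ => ?_⟩
  · exact (Measurable.of_discrete (f := fun u : ℤˣ => -u)).comp (measurable_pi_apply x)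
  · funext x
    by_cases h : x ∈ Λ <;> simp [glue, h]
  · have h (x : Site d) : spin (fun x => -σ x) x = -spin σ x := by simp [spin]
    simp [localHamiltonian, h]

/-- In a phase of zero magnetization the density correlation is an affine function of the spin
correlation. -/
lemma densityCorrelation_eq {d : ℕ} {μ : Measure (SpinConfig d)} [IsProbabilityMeasure μ]
    (hflip : μ.map (fun σ x => -σ x) = μ) (x : Site d) :
    densityCorrelation μ x = (1 + spinCorrelation μ x) / 4 := by
  have hm : Measurable fun (σ : SpinConfig d) x => -σ x := measurable_pi_lambda _ fun x =>
    (Measurable.of_discrete (f := fun u : ℤˣ => -u)).comp (measurable_pi_apply x)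
  have h0 (y : Site d) : ∫ σ, spin σ y ∂μ = 0 := by
    have h : ∫ σ, spin σ y ∂μ = -∫ σ, spin σ y ∂μ := by
      conv_lhs => rw [← hflip]
      rw [integral_map hm.aemeasurable (continuous_spin y).measurable.aestronglyMeasurable,
        ← integral_neg]
      simp [spin]
    linarith
  have hi (y : Site d) : Integrable (fun σ => spin σ y) μ :=
    integrable_of_continuous (continuous_spin y)
  have hi2 : Integrable (fun σ => spin σ 0 * spin σ x) μ :=
    integrable_of_continuous ((continuous_spin 0).mul (continuous_spin x))
  unfold densityCorrelation spinCorrelation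
  have : ∀ σ : SpinConfig d, occupation σ 0 * occupation σ x =
      (1 / 4) * (spin σ 0 * spin σ x + (spin σ 0 + spin σ x + 1)) := fun σ => by
    unfold occupation; ring
  simp_rw [this]
  have hi3 : Integrable (fun σ => spin σ 0 + spin σ x) μ := (hi 0).add (hi x)
  have hi4 : Integrable (fun σ => spin σ 0 + spin σ x + 1) μ := hi3.add (integrable_const 1)
  rw [integral_const_mul, integral_add hi2 hi4,
    integral_add hi3 (integrable_const 1), integral_add (hi 0) (hi x), h0, h0]
  simp
  ring

/-! ### Uniform mixing -/

/-- Uniqueness of the Gibbs measure forces uniform mixing: a continuous observable is almost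
uncorrelated with any nonnegative observable of the spins outside a large volume. Otherwise
the normalized densities `g` for larger and larger volumes would define measures that satisfy
more and more DLR equations and, by compactness, would accumulate at a second Gibbs measure. -/
theorem exists_finset_abs_integral_mul_sub_le {d : ℕ} {J : Site d → ℝ}
    (hJ : Summable fun x => |J x|) {β : ℝ} {μ : Measure (SpinConfig d)}
    (hμ : IsGibbsMeasure J β μ)
    (hunique : ∀ μ' : Measure (SpinConfig d), IsGibbsMeasure J β μ' → μ' = μ)
    {f : SpinConfig d → ℝ} (hf : Continuous f) {ε : ℝ} (hε : 0 < ε) :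
    ∃ Λ : Finset (Site d), ∀ g : SpinConfig d → ℝ, Continuous g → (∀ σ, 0 ≤ g σ) →
      DependsOn g (Λ : Set (Site d))ᶜ →
      |∫ σ, g σ * f σ ∂μ - (∫ σ, g σ ∂μ) * ∫ σ, f σ ∂μ| ≤ ε * ∫ σ, g σ ∂μ := by
  have := hμ.isProbabilityMeasure
  by_contra! hcon
  choose g hgc hg0 hgΛ hgf using hcon
  -- The density `g Λ` has positive integral, since otherwise both sides vanish.
  have hpos (Λ : Finset (Site d)) : 0 < ∫ σ, g Λ σ ∂μ := by
    refine (integral_nonneg (hg0 Λ)).lt_of_ne' fun h0 => ?_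
    have hae : g Λ =ᵐ[μ] 0 := (integral_eq_zero_iff_of_nonneg (hg0 Λ)
      (integrable_of_continuous (hgc Λ))).1 h0
    have h1 : ∫ σ, g Λ σ * f σ ∂μ = 0 := by
      rw [integral_congr_ae (g := fun _ => (0 : ℝ)), integral_zero]
      filter_upwards [hae] with σ hσ
      simp [hσ]
    have := hgf Λ
    rw [h0, h1] at this
    simp at this
  set c : Finset (Site d) → ℝ := fun Λ => (∫ σ, g Λ σ ∂μ)⁻¹ with hc
  have hc0 (Λ) : 0 < c Λ := inv_pos.2 (hpos Λ)
  set G : Finset (Site d) → SpinConfig d → ℝ≥0∞ := fun Λ σ => ENNReal.ofReal (c Λ * g Λ σ) with hG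
  have hGm (Λ) : Measurable (G Λ) := ((hgc Λ).measurable.const_mul _).ennreal_ofReal
  have hint (Λ) (h : SpinConfig d → ℝ) :
      ∫ σ, h σ ∂μ.withDensity (G Λ) = c Λ * ∫ σ, g Λ σ * h σ ∂μ := by
    rw [integral_withDensity_eq_integral_toReal_smul (hGm Λ) (by simp [hG]), ← integral_const_mul]
    refine integral_congr_ae (ae_of_all _ fun σ => ?_)
    simp only [hG, smul_eq_mul]
    rw [ENNReal.toReal_ofReal (mul_nonneg (hc0 Λ).le (hg0 Λ σ)), mul_assoc]
  have hprob (Λ) : IsProbabilityMeasure (μ.withDensity (G Λ)) := by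
    constructor
    rw [withDensity_apply _ MeasurableSet.univ, Measure.restrict_univ, hG,
      ← ofReal_integral_eq_lintegral_ofReal
        ((integrable_of_continuous (hgc Λ)).const_mul _)
        (ae_of_all _ fun σ => mul_nonneg (hc0 Λ).le (hg0 Λ σ)),
      integral_const_mul, hc, inv_mul_cancel₀ (hpos Λ).ne', ENNReal.ofReal_one]
  -- Along an ultrafilter on the finite volumes, the modified measures converge.
  set 𝓤 : Ultrafilter (Finset (Site d)) := Ultrafilter.of atTop with h𝓤
  have h𝓤le : (𝓤 : Filter (Finset (Site d))) ≤ atTop := Ultrafilter.of_le atTop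
  set P : Finset (Site d) → ProbabilityMeasure (SpinConfig d) := fun Λ => ⟨_, hprob Λ⟩ with hP
  obtain ⟨ν, hν⟩ : ∃ ν, Tendsto P 𝓤 (𝓝 ν) := by
    obtain ⟨ν, -, h⟩ := isCompact_univ.ultrafilter_le_nhds (𝓤.map P) (by simp)
    exact ⟨ν, h⟩
  have hlim (h : SpinConfig d → ℝ) (hh : Continuous h) :
      Tendsto (fun Λ => ∫ σ, h σ ∂μ.withDensity (G Λ)) 𝓤
        (𝓝 (∫ σ, h σ ∂(ν : Measure (SpinConfig d)))) :=
    ProbabilityMeasure.tendsto_iff_forall_integral_tendsto.1 hν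
      (BoundedContinuousFunction.mkOfCompact ⟨h, hh⟩)
  have hgibbs : IsGibbsMeasure J β (ν : Measure (SpinConfig d)) := by
    refine ⟨inferInstance, fun Λ => (bind_gibbsDistribution_eq_iff hJ).1 ?_⟩
    have hK := measurable_gibbsDistribution hJ β Λ
    have hKp (μ' : Measure (SpinConfig d)) [IsProbabilityMeasure μ'] :
        IsProbabilityMeasure (μ'.bind (gibbsDistribution J β Λ)) :=
      isProbabilityMeasure_bind hK.aemeasurable (ae_of_all _ fun _ => inferInstance)
    have hbind (μ' : Measure (SpinConfig d)) [IsProbabilityMeasure μ'] (h : SpinConfig d → ℝ)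
        (hh : Continuous h) : ∫ σ, h σ ∂μ'.bind (gibbsDistribution J β Λ) =
          ∫ ω, ∫ σ, h σ ∂gibbsDistribution J β Λ ω ∂μ' := by
      have := hKp μ'
      let κ : ProbabilityTheory.Kernel (SpinConfig d) (SpinConfig d) :=
        ⟨gibbsDistribution J β Λ, hK⟩
      have hκ := Measure.comp_eq_comp_const_apply (μ := μ') (κ := κ)
      have hi : Integrable h (μ'.bind κ) := integrable_of_continuous hh
      rw [hκ] at hi
      refine (congrArg (fun m => ∫ σ, h σ ∂m) hκ).trans ?_
      exact ProbabilityTheory.Kernel.integral_comp hi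
    have := hKp ν
    refine ext_of_forall_integral_eq_of_IsFiniteMeasure fun h => ?_
    rw [hbind _ _ h.continuous]
    refine tendsto_nhds_unique (hlim _ (continuous_integral_gibbsDistribution hJ β Λ h.continuous))
      ((hlim _ h.continuous).congr' ?_)
    filter_upwards [h𝓤le (mem_atTop Λ)] with Λ' hΛ'
    rw [← hbind _ _ h.continuous, bind_gibbsDistribution_withDensity hJ
      ((bind_gibbsDistribution_eq_iff hJ).2 (hμ.dlr Λ)) (hGm Λ')]
    intro x y hxy
    simp only [hG]
    rw [hgΛ Λ' fun i hi => hxy i fun hi' => hi (hΛ' hi')]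
  have hνμ : (ν : Measure (SpinConfig d)) = μ := hunique _ hgibbs
  have h1 := ((hlim f hf).sub_const (∫ σ, f σ ∂μ)).abs
  rw [hνμ, sub_self, abs_zero] at h1
  obtain ⟨Λ, hΛ⟩ := (h1.eventually (gt_mem_nhds hε)).exists
  refine (hgf Λ).not_ge ?_
  rw [hint, show ∫ σ, f σ ∂μ = c Λ * ((∫ σ, g Λ σ ∂μ) * ∫ σ, f σ ∂μ) by
    rw [← mul_assoc, hc, inv_mul_cancel₀ (hpos Λ).ne', one_mul], ← mul_sub, abs_mul,
    abs_of_pos (hc0 Λ)] at hΛ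
  have : |∫ σ, g Λ σ * f σ ∂μ - (∫ σ, g Λ σ ∂μ) * ∫ σ, f σ ∂μ| = (∫ σ, g Λ σ ∂μ) *
      (c Λ * |∫ σ, g Λ σ * f σ ∂μ - (∫ σ, g Λ σ ∂μ) * ∫ σ, f σ ∂μ|) := by
    rw [← mul_assoc, hc, mul_inv_cancel₀ (hpos Λ).ne', one_mul]
  rw [this, mul_comm ε]
  exact mul_le_mul_of_nonneg_left hΛ.le (hpos Λ).le

/-! ### Concentration of spatial averages -/

/-- The exponential moment of a sum of translates of a local observable `F`, over a set of
translations so sparse that the mixing hypothesis for the volume `Λ` decouples any translate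
from the others. -/
lemma integral_exp_sum_shift_le {d : ℕ} {μ : Measure (SpinConfig d)} [IsProbabilityMeasure μ]
    (hshift : ∀ a : Site d, μ.map (shift a) = μ) {F : SpinConfig d → ℝ} (hF : Continuous F)
    (hF1 : ∀ σ, |F σ| ≤ 1) {S Λ : Finset (Site d)} (hFS : DependsOn F (S : Set (Site d)))
    {t : ℝ} (ht0 : 0 ≤ t) (ht1 : t ≤ 1)
    (hmix : ∀ g : SpinConfig d → ℝ, Continuous g → (∀ σ, 0 ≤ g σ) →
      DependsOn g (Λ : Set (Site d))ᶜ → ∫ σ, g σ * F σ ∂μ ≤ t * ∫ σ, g σ ∂μ)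
    (V : Finset (Site d))
    (hV : ∀ x ∈ V, ∀ y ∈ V, x ≠ y → ∀ s ∈ S, s + y - x ∉ Λ) :
    ∫ σ, Real.exp (t * ∑ x ∈ V, F (shift x σ)) ∂μ ≤ Real.exp (2 * t ^ 2 * V.card) := by
  have hc (V : Finset (Site d)) :
      Continuous fun σ => Real.exp (t * ∑ x ∈ V, F (shift x σ)) :=
    Real.continuous_exp.comp (continuous_const.mul
      (continuous_finsetSum _ fun x _ => hF.comp (continuous_shift x)))
  induction V using Finset.induction_on with
  | empty => simp
  | insert a V ha ih =>
    have ih := ih fun x hx y hy =>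
      hV x (Finset.mem_insert_of_mem hx) y (Finset.mem_insert_of_mem hy)
    set g : SpinConfig d → ℝ := fun σ => Real.exp (t * ∑ x ∈ V, F (shift x σ)) with hg
    have hFa : Continuous fun σ => F (shift a σ) := hF.comp (continuous_shift a)
    -- After translating by `-a`, the other factors only see spins outside `Λ`.
    have hdep : DependsOn (fun σ => g (shift (-a) σ)) (Λ : Set (Site d))ᶜ := by
      intro σ σ' h
      simp only [hg]
      congr 2
      refine Finset.sum_congr rfl fun x hx => hFS fun s hs => h _ ?_
      have := hV a (Finset.mem_insert_self a V) x (Finset.mem_insert_of_mem hx)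
        (fun h => ha (h ▸ hx)) s hs
      simpa [sub_eq_add_neg] using this
    have hmap (h : SpinConfig d → ℝ) (hh : Continuous h) :
        ∫ σ, h (shift a σ) ∂μ = ∫ σ, h σ ∂μ := by
      conv_rhs => rw [← hshift a]
      rw [integral_map (continuous_shift a).measurable.aemeasurable
        hh.measurable.aestronglyMeasurable]
    have hgc : Continuous fun σ => g (shift (-a) σ) := (hc V).comp (continuous_shift _)
    have hgF : ∫ σ, g σ * F (shift a σ) ∂μ ≤ t * ∫ σ, g σ ∂μ := by
      have h1 := hmap (fun σ => g (shift (-a) σ) * F σ) (hgc.mul hF)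
      have h2 := hmap (fun σ => g (shift (-a) σ)) hgc
      simp only [shift_neg_shift] at h1 h2
      rw [h1, h2]
      exact hmix _ hgc (fun _ => (Real.exp_pos _).le) hdep
    have hg0 : 0 ≤ ∫ σ, g σ ∂μ := integral_nonneg fun _ => (Real.exp_pos _).le
    have hpt (σ) : Real.exp (t * ∑ x ∈ insert a V, F (shift x σ)) ≤
        (1 + t ^ 2) * g σ + t * (g σ * F (shift a σ)) := by
      -- The factor of the new site is linearized by `exp u ≤ 1 + u + u ^ 2` for `|u| ≤ 1`.
      have hx : |t * F (shift a σ)| ≤ t := by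
        rw [abs_mul, abs_of_nonneg ht0]
        exact mul_le_of_le_one_right ht0 (hF1 _)
      have h1 := (abs_le.1 (Real.abs_exp_sub_one_sub_id_le (hx.trans ht1))).2
      have h2 : (t * F (shift a σ)) ^ 2 ≤ t ^ 2 := sq_le_sq.2 (by rwa [abs_of_nonneg ht0])
      rw [Finset.sum_insert ha, mul_add, Real.exp_add]
      calc _ ≤ (1 + t ^ 2 + t * F (shift a σ)) * g σ :=
            mul_le_mul_of_nonneg_right (by linarith) (Real.exp_pos _).le
        _ = _ := by ring
    have hi1 : Integrable (fun σ => (1 + t ^ 2) * g σ) μ :=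
      (integrable_of_continuous (hc V)).const_mul _
    have hi2 : Integrable (fun σ => t * (g σ * F (shift a σ))) μ :=
      (integrable_of_continuous ((hc V).mul hFa)).const_mul _
    calc _ ≤ ∫ σ, ((1 + t ^ 2) * g σ + t * (g σ * F (shift a σ))) ∂μ :=
          integral_mono (integrable_of_continuous (hc _)) (hi1.add hi2) hpt
      _ = (1 + t ^ 2) * ∫ σ, g σ ∂μ + t * ∫ σ, g σ * F (shift a σ) ∂μ := by
          rw [integral_add hi1 hi2, integral_const_mul, integral_const_mul]
      _ ≤ (1 + t ^ 2) * ∫ σ, g σ ∂μ + t * (t * ∫ σ, g σ ∂μ) := by gcongr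
      _ = (2 * t ^ 2 + 1) * ∫ σ, g σ ∂μ := by ring
      _ ≤ Real.exp (2 * t ^ 2) * Real.exp (2 * t ^ 2 * V.card) :=
          mul_le_mul (Real.add_one_le_exp _) ih hg0 (Real.exp_pos _).le
      _ = _ := by
          rw [← Real.exp_add, Finset.card_insert_of_notMem ha]
          push_cast
          ring_nf

/-- Two distinct sites that are congruent modulo a large number `N` are far apart. -/
lemma exists_modulus_forall_add_sub_notMem {d : ℕ} (S Λ : Finset (Site d)) :
    ∃ N : ℕ, N ≠ 0 ∧ ∀ x y : Site d, (∀ i, (x i : ZMod N) = (y i : ZMod N)) → x ≠ y →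
      ∀ s ∈ S, s + y - x ∉ Λ := by
  classical
  obtain ⟨B, hB⟩ := (((Λ ×ˢ S) ×ˢ (Finset.univ : Finset (Fin d))).image
    fun q => (q.1.1 q.2 - q.1.2 q.2).natAbs).exists_le
  refine ⟨B + 1, by omega, fun x y hxy hne s hs hl => hne (funext fun i => ?_)⟩
  have h1 := (ZMod.intCast_eq_intCast_iff_dvd_sub _ _ _).1 (hxy i)
  have h2 : (s + y - x) i - s i = y i - x i := by
    simp only [Pi.sub_apply, Pi.add_apply]
    ring
  have h3 := hB _ (Finset.mem_image_of_mem _ (Finset.mk_mem_product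
    (Finset.mk_mem_product hl hs) (Finset.mem_univ i)))
  simp only [h2] at h3
  have h4 : y i - x i = 0 := by
    refine Int.eq_zero_of_abs_lt_dvd h1 ?_
    rw [Int.abs_eq_natAbs]
    exact_mod_cast Nat.lt_succ_of_le h3
  exact (sub_eq_zero.1 h4).symm

/-- An exponential upper bound for large deviations of the sum of the translates of a local
observable. The translations are split into the residue classes modulo some `N`; within each
class the Chernoff bound applies. -/
lemma exists_measure_sum_shift_le {d : ℕ} {μ : Measure (SpinConfig d)} [IsProbabilityMeasure μ]
    (hshift : ∀ a : Site d, μ.map (shift a) = μ) {F : SpinConfig d → ℝ} (hF : Continuous F)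
    (hF1 : ∀ σ, |F σ| ≤ 1) {S : Finset (Site d)} (hFS : DependsOn F (S : Set (Site d)))
    {ε : ℝ} (hε0 : 0 < ε) (hε1 : ε ≤ 1)
    (hmix : ∃ Λ : Finset (Site d), ∀ g : SpinConfig d → ℝ, Continuous g → (∀ σ, 0 ≤ g σ) →
      DependsOn g (Λ : Set (Site d))ᶜ → ∫ σ, g σ * F σ ∂μ ≤ ε * ∫ σ, g σ ∂μ) :
    ∃ C a : ℝ, 0 < a ∧ ∀ V : Finset (Site d),
      μ.real {σ | 3 * ε * V.card ≤ ∑ x ∈ V, F (shift x σ)} ≤ C * Real.exp (-a * V.card) := by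
  classical
  obtain ⟨Λ, hΛ⟩ := hmix
  obtain ⟨N, hN, hsep⟩ := exists_modulus_forall_add_sub_notMem S Λ
  have : NeZero N := ⟨hN⟩
  set K : ℝ := (Fintype.card (Fin d → ZMod N) : ℝ) with hK
  have hK0 : 0 < K := by rw [hK]; exact_mod_cast Fintype.card_pos
  refine ⟨K, ε * (ε / K), by positivity, fun V => ?_⟩
  set W : (Fin d → ZMod N) → Finset (Site d) := fun c =>
    V.filter fun x => (fun i => (x i : ZMod N)) = c
  set E : (Fin d → ZMod N) → Set (SpinConfig d) := fun c =>
    {σ | 2 * ε * (W c).card + ε / K * V.card ≤ ∑ x ∈ W c, F (shift x σ)} with hE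
  -- The thresholds of the `K` classes add up to `3 ε |V|`, so that no estimate of the sizes of the
  -- individual classes is needed.
  have hsub : {σ | 3 * ε * V.card ≤ ∑ x ∈ V, F (shift x σ)} ⊆ ⋃ c, E c := by
    intro σ hσ
    by_contra hcon
    simp only [Set.mem_iUnion, not_exists, hE, Set.mem_ofPred_eq, not_le] at hcon
    refine absurd (show 3 * ε * V.card ≤ ∑ x ∈ V, F (shift x σ) from hσ) (not_le.2 ?_)
    have hcard : ∑ c, ((W c).card : ℝ) = V.card := by
      have := Finset.card_eq_sum_card_fiberwise (s := V) (t := Finset.univ)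
        (f := fun x : Site d => fun i => (x i : ZMod N))
        (fun _ _ => Finset.mem_coe.2 (Finset.mem_univ _))
      rw [this]
      push_cast
      rfl
    calc ∑ x ∈ V, F (shift x σ) = ∑ c, ∑ x ∈ W c, F (shift x σ) :=
          (Finset.sum_fiberwise V _ _).symm
      _ < ∑ c, (2 * ε * (W c).card + ε / K * V.card) :=
          Finset.sum_lt_sum_of_nonempty Finset.univ_nonempty fun c _ => hcon c
      _ = 3 * ε * V.card := by
          rw [Finset.sum_add_distrib, ← Finset.mul_sum, hcard, Finset.sum_const, Finset.card_univ,
            nsmul_eq_mul, ← hK]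
          field_simp
          ring
  have hEc (c) : μ.real (E c) ≤ Real.exp (-(ε * (ε / K)) * V.card) := by
    have hcont : Continuous fun σ => ∑ x ∈ W c, F (shift x σ) :=
      continuous_finsetSum _ fun x _ => hF.comp (continuous_shift x)
    have h1 := ProbabilityTheory.measure_ge_le_exp_mul_mgf (μ := μ)
      (X := fun σ => ∑ x ∈ W c, F (shift x σ)) (2 * ε * (W c).card + ε / K * V.card) hε0.le
      (integrable_of_continuous (Real.continuous_exp.comp (continuous_const.mul hcont)))
    have h2 := integral_exp_sum_shift_le hshift hF hF1 hFS hε0.le hε1 hΛ (W c)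
      fun x hx y hy hne => hsep x y (fun i => by
        have hx' := (Finset.mem_filter.1 hx).2
        have hy' := (Finset.mem_filter.1 hy).2
        exact congrFun (hx'.trans hy'.symm) i) hne
    refine h1.trans ((mul_le_mul_of_nonneg_left h2 (Real.exp_pos _).le).trans ?_)
    rw [← Real.exp_add]
    refine Real.exp_le_exp.2 (le_of_eq ?_)
    ring
  calc _ ≤ μ.real (⋃ c, E c) := measureReal_mono hsub
    _ ≤ ∑ c, μ.real (E c) := measureReal_iUnion_fintype_le E
    _ ≤ ∑ _c : Fin d → ZMod N, Real.exp (-(ε * (ε / K)) * V.card) :=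
        Finset.sum_le_sum fun c _ => hEc c
    _ = _ := by rw [Finset.sum_const, Finset.card_univ, nsmul_eq_mul, ← hK]

/-- The pointwise ergodic theorem for local observables of the unique Gibbs measure, along
volumes whose sizes grow fast enough for the Borel-Cantelli lemma. -/
theorem ae_tendsto_average_shift {d : ℕ} {J : Site d → ℝ}
    (hJ : Summable fun x => |J x|) {β : ℝ} {μ : Measure (SpinConfig d)}
    (hμ : IsGibbsMeasure J β μ)
    (hunique : ∀ μ' : Measure (SpinConfig d), IsGibbsMeasure J β μ' → μ' = μ)
    {f : SpinConfig d → ℝ} (hf : Continuous f) (hf1 : ∀ σ, |f σ - ∫ σ, f σ ∂μ| ≤ 1)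
    {S : Finset (Site d)} (hfS : DependsOn f (S : Set (Site d))) (V : ℕ → Finset (Site d))
    (hV : ∀ a : ℝ, 0 < a → Summable fun m => Real.exp (-a * (V m).card)) :
    ∀ᵐ σ ∂μ, Tendsto (fun m => (∑ x ∈ V m, (f (shift x σ) - ∫ σ, f σ ∂μ)) / (V m).card)
      atTop (𝓝 0) := by
  have := hμ.isProbabilityMeasure
  have hshift (a : Site d) : μ.map (shift a) = μ := hunique _ (hμ.map_shift hJ a)
  -- The sign `θ = ±1` gives the upper and the lower deviations at once.
  have key (θ : ℝ) (hθ : |θ| = 1) (k : ℕ) : ∀ᵐ σ ∂μ, ∀ᶠ m in atTop,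
      θ * ∑ x ∈ V m, (f (shift x σ) - ∫ σ, f σ ∂μ) < 3 * (1 / (k + 1 : ℝ)) * (V m).card := by
    have hε0 : (0 : ℝ) < 1 / (k + 1 : ℝ) := by positivity
    have hε1 : (1 : ℝ) / (k + 1 : ℝ) ≤ 1 := by
      rw [div_le_one (by positivity)]; linarith [k.cast_nonneg (α := ℝ)]
    have hFc : Continuous fun σ => θ * (f σ - ∫ σ, f σ ∂μ) :=
      continuous_const.mul (hf.sub continuous_const)
    obtain ⟨C, a, ha, hC⟩ := exists_measure_sum_shift_le (μ := μ) hshift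
      (F := fun σ => θ * (f σ - ∫ σ, f σ ∂μ)) hFc
      (fun σ => by rw [abs_mul, hθ, one_mul]; exact hf1 σ) (S := S)
      (fun σ σ' h => by simp only [hfS h]) hε0 hε1 (by
        obtain ⟨Λ, hΛ⟩ := exists_finset_abs_integral_mul_sub_le hJ hμ hunique hf hε0
        refine ⟨Λ, fun g hg hg0 hgd => ?_⟩
        have h1 : ∫ σ, g σ * (θ * (f σ - ∫ σ, f σ ∂μ)) ∂μ =
            θ * (∫ σ, g σ * f σ ∂μ - (∫ σ, g σ ∂μ) * ∫ σ, f σ ∂μ) := by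
          have hi : Integrable (fun σ => g σ * f σ) μ := integrable_of_continuous (hg.mul hf)
          rw [← integral_mul_const, ← integral_sub hi
            ((integrable_of_continuous hg).mul_const _), ← integral_const_mul]
          congr 1; ext σ; ring
        rw [h1]
        refine (le_abs_self _).trans ?_
        rw [abs_mul, hθ, one_mul]
        exact hΛ g hg hg0 hgd)
    have hsum : ∑' m, μ {σ | 3 * (1 / (k + 1 : ℝ)) * (V m).card ≤
        ∑ x ∈ V m, θ * (f (shift x σ) - ∫ σ, f σ ∂μ)} ≠ ⊤ := by
      have hs := (hV a ha).mul_left C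
      refine ((ENNReal.tsum_le_tsum fun m => ?_).trans_lt
        (hs.tsum_ofReal_lt_top)).ne
      rw [← ofReal_measureReal]
      exact ENNReal.ofReal_le_ofReal (hC (V m))
    filter_upwards [ae_eventually_notMem hsum] with σ hσ
    filter_upwards [hσ] with m hm
    rw [Finset.mul_sum]
    simpa only [Set.mem_ofPred_eq, not_le] using hm
  have hall : ∀ᵐ σ ∂μ, ∀ k : ℕ, (∀ᶠ m in atTop,
      1 * ∑ x ∈ V m, (f (shift x σ) - ∫ σ, f σ ∂μ) < 3 * (1 / (k + 1 : ℝ)) * (V m).card) ∧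
      ∀ᶠ m in atTop,
      -1 * ∑ x ∈ V m, (f (shift x σ) - ∫ σ, f σ ∂μ) < 3 * (1 / (k + 1 : ℝ)) * (V m).card :=
    ae_all_iff.2 fun k => (key 1 (by simp) k).and (key (-1) (by simp) k)
  filter_upwards [hall] with σ hσ
  rw [Metric.tendsto_nhds]
  intro ε hε
  obtain ⟨k, hk⟩ := exists_nat_one_div_lt (show 0 < ε / 3 by positivity)
  filter_upwards [(hσ k).1, (hσ k).2] with m h1 h2
  have hpos : (0 : ℝ) < (V m).card := by
    by_contra h
    have : ((V m).card : ℝ) = 0 := le_antisymm (not_lt.1 h) (Nat.cast_nonneg _)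
    rw [this] at h1 h2
    linarith
  rw [Real.dist_0_eq_abs, abs_div, abs_of_pos hpos, div_lt_iff₀ hpos]
  have h3 : 3 * (1 / (k + 1 : ℝ)) * (V m).card < ε * (V m).card :=
    mul_lt_mul_of_pos_right (by linarith) hpos
  exact abs_lt.2 ⟨by linarith, by linarith⟩

/-! ### Lattice points in balls -/

lemma sitePoint_add {d : ℕ} (x y : Site d) : sitePoint (x + y) = sitePoint x + sitePoint y := by
  ext i; simp [sitePoint]

lemma sitePoint_neg {d : ℕ} (x : Site d) : sitePoint (-x) = -sitePoint x := by
  ext i; simp [sitePoint]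

lemma sitePoint_sub {d : ℕ} (x y : Site d) : sitePoint (x - y) = sitePoint x - sitePoint y := by
  ext i; simp [sitePoint]

lemma sitePoint_injective {d : ℕ} : Function.Injective (sitePoint (d := d)) := by
  intro x y h
  funext i
  have := congrArg (fun v : RSpace d => v i) h
  simpa [sitePoint] using this

lemma norm_sitePoint_sq {d : ℕ} (x : Site d) : ‖sitePoint x‖ ^ 2 = ((∑ i, x i ^ 2 : ℤ) : ℝ) := by
  rw [EuclideanSpace.norm_sq_eq]
  simp [sitePoint]

lemma finite_setOf_sitePoint_mem_ball {d : ℕ} (r : ℝ) :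
    {x : Site d | sitePoint x ∈ Metric.ball (0 : RSpace d) r}.Finite := by
  refine (Set.Finite.pi' fun _ : Fin d => Set.finite_Icc (-⌈r⌉) ⌈r⌉).subset fun x hx i => ?_
  have h1 : ‖sitePoint x‖ < r := by simpa using hx
  have h2 : |(x i : ℝ)| ≤ ‖sitePoint x‖ := PiLp.norm_apply_le (sitePoint x) i
  have h3 := abs_le.1 ((h2.trans h1.le).trans (Int.le_ceil r))
  exact ⟨by exact_mod_cast h3.1, by exact_mod_cast h3.2⟩

/-- The sites in the open ball of radius `r` about the origin. -/
noncomputable def ballSites (d : ℕ) (r : ℝ) : Finset (Site d) :=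
  (finite_setOf_sitePoint_mem_ball r).toFinset

lemma mem_ballSites {d : ℕ} {r : ℝ} {x : Site d} : x ∈ ballSites d r ↔ ‖sitePoint x‖ < r := by
  simp [ballSites]

/-- The sites `x` for which both `x` and `x + z` lie in the open ball of radius `r`. -/
noncomputable def pairSites {d : ℕ} (z : Site d) (r : ℝ) : Finset (Site d) :=
  (ballSites d r).filter fun x => ‖sitePoint (x + z)‖ < r

lemma mem_pairSites {d : ℕ} {z : Site d} {r : ℝ} {x : Site d} :
    x ∈ pairSites z r ↔ ‖sitePoint x‖ < r ∧ ‖sitePoint (x + z)‖ < r := by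
  simp [pairSites, mem_ballSites]

/-- Since squared norms of lattice points are integers, only countably many sets of sites
arise from balls. -/
lemma pairSites_sqrt_ceil {d : ℕ} (z : Site d) {r : ℝ} (hr : 0 < r) :
    pairSites z (√(⌈r ^ 2⌉₊ : ℕ)) = pairSites z r := by
  have key (x : Site d) : ‖sitePoint x‖ < √(⌈r ^ 2⌉₊ : ℕ) ↔ ‖sitePoint x‖ < r := by
    rw [Real.lt_sqrt (norm_nonneg _), ← sq_lt_sq₀ (norm_nonneg _) hr.le, norm_sitePoint_sq]
    have h0 : 0 ≤ ∑ i, x i ^ 2 := Finset.sum_nonneg fun _ _ => sq_nonneg _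
    obtain ⟨n, hn⟩ := Int.eq_ofNat_of_zero_le h0
    rw [hn]
    simp only [Int.cast_natCast, Nat.cast_lt]
    exact Nat.lt_ceil
  ext x
  simp only [mem_pairSites, key]

lemma volume_ball_toReal {d : ℕ} {r : ℝ} (hr : 0 < r) :
    (volume (Metric.ball (0 : RSpace d) r)).toReal =
      r ^ d * (volume (Metric.ball (0 : RSpace d) 1)).toReal := by
  rw [Measure.addHaar_ball_of_pos _ _ hr]
  simp [ENNReal.toReal_mul, hr.le]

lemma volume_unitBall_pos (d : ℕ) : 0 < (volume (Metric.ball (0 : RSpace d) 1)).toReal :=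
  ENNReal.toReal_pos (Metric.measure_ball_pos _ _ one_pos).ne' measure_ball_lt_top.ne

open scoped Pointwise in
lemma tendsto_card_ballSites_div_pow (d : ℕ) :
    Tendsto (fun r : ℝ => ((ballSites d r).card : ℝ) / r ^ d) atTop
      (𝓝 (volume (Metric.ball (0 : RSpace d) 1)).toReal) := by
  set s : Set (Fin d → ℝ) := WithLp.toLp 2 ⁻¹' Metric.ball (0 : RSpace d) 1 with hs
  have hmp := (EuclideanSpace.volume_preserving_symm_measurableEquiv_toLp (Fin d)).symm
  have hconv : Convex ℝ s :=
    (convex_ball (0 : RSpace d) 1).linear_preimage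
      (WithLp.linearEquiv 2 ℝ (Fin d → ℝ)).symm.toLinearMap
  have hmeas : MeasurableSet s := (WithLp.measurable_toLp 2 (Fin d → ℝ)) measurableSet_ball
  have hbdd : Bornology.IsBounded s := by
    refine (Metric.isBounded_ball (x := (0 : Fin d → ℝ)) (r := 1)).subset fun x hx => ?_
    have h1 : ‖(WithLp.toLp 2 x : RSpace d)‖ < 1 := by simpa [hs] using hx
    rw [mem_ball_zero_iff, pi_norm_lt_iff one_pos]
    exact fun i => (PiLp.norm_apply_le (WithLp.toLp 2 x : RSpace d) i).trans_lt h1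
  have hvol : volume.real s = (volume (Metric.ball (0 : RSpace d) 1)).toReal := by
    rw [measureReal_def]
    congr 1
    exact hmp.measure_preimage measurableSet_ball.nullMeasurableSet
  have hmono : ∀ ⦃x y : ℝ⦄, 0 < x → x ≤ y → x • s ⊆ y • s := by
    intro x y hx hxy v hv
    have hy := hx.trans_le hxy
    rw [Set.mem_smul_set_iff_inv_smul_mem₀ hx.ne'] at hv
    rw [Set.mem_smul_set_iff_inv_smul_mem₀ hy.ne']
    simp only [hs, Set.mem_preimage, mem_ball_zero_iff, WithLp.toLp_smul, norm_smul, norm_inv,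
      Real.norm_eq_abs, abs_of_pos hx, abs_of_pos hy] at hv ⊢
    exact (mul_le_mul_of_nonneg_right (inv_anti₀ hx hxy) (norm_nonneg _)).trans_lt hv
  have h := tendsto_card_div_pow_atTop_volume' s hbdd hmeas (hconv.addHaar_frontier _) hmono
  rw [hvol, Fintype.card_fin] at h
  refine h.congr' ?_
  filter_upwards [eventually_gt_atTop 0] with r hr
  congr 2
  -- The points of `s` in the scaled lattice are the scaled sites in the ball of radius `r`.
  have himage : s ∩ r⁻¹ • (Submodule.span ℤ (Set.range (Pi.basisFun ℝ (Fin d))) : Set (Fin d → ℝ)) =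
      (fun (x : Site d) => r⁻¹ • fun i => (x i : ℝ)) '' (ballSites d r : Set (Site d)) := by
    have hn (x : Site d) : r⁻¹ • (fun i => (x i : ℝ)) ∈ s ↔ x ∈ ballSites d r := by
      simp only [hs, Set.mem_preimage, mem_ball_zero_iff, WithLp.toLp_smul, norm_smul, norm_inv,
        Real.norm_eq_abs, abs_of_pos hr, mem_ballSites, inv_mul_lt_iff₀ hr, mul_one]
      rfl
    ext v
    constructor
    · rintro ⟨hv, w, hw, rfl⟩
      have hw' := (Module.Basis.mem_span_iff_repr_mem ℤ (Pi.basisFun ℝ (Fin d)) w).1 hw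
      choose x hx using hw'
      have hxw : (fun i => (x i : ℝ)) = w := by
        funext i
        simpa using hx i
      subst hxw
      exact ⟨x, (hn x).1 hv, rfl⟩
    · rintro ⟨x, hx, rfl⟩
      refine ⟨(hn x).2 hx, _, ?_, rfl⟩
      exact (Module.Basis.mem_span_iff_repr_mem ℤ (Pi.basisFun ℝ (Fin d)) _).2
        fun i => ⟨x i, by simp⟩
  have hinj : Function.Injective fun (x : Site d) => r⁻¹ • fun i => (x i : ℝ) := by
    intro x y hxy
    funext i
    have := congrFun (smul_right_injective _ (inv_ne_zero hr.ne') hxy) i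
    exact_mod_cast this
  rw [himage, Nat.card_coe_set_eq, Set.ncard_image_of_injective _ hinj, Set.ncard_coe_finset]

/-- The number of lattice points `x` for which `x` and `x + z` lie in a ball is asymptotic to the
volume of the ball. -/
lemma tendsto_card_pairSites_div_pow {d : ℕ} (z : Site d) :
    Tendsto (fun r : ℝ => ((pairSites z r).card : ℝ) / r ^ d) atTop
      (𝓝 (volume (Metric.ball (0 : RSpace d) 1)).toReal) := by
  -- The ball of radius `r - ‖z‖` is contained in the ball of radius `r` about `0` and about `-z`.
  set c := ‖sitePoint z‖
  have hsub : Tendsto (fun r : ℝ => r - c) atTop atTop :=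
    tendsto_atTop_add_const_right _ _ tendsto_id
  have h1 := (tendsto_card_ballSites_div_pow d).comp hsub
  have h2 : Tendsto (fun r : ℝ => ((r - c) / r) ^ d) atTop (𝓝 1) := by
    have : Tendsto (fun r : ℝ => 1 - c / r) atTop (𝓝 1) := by
      simpa using (tendsto_const_nhds (x := (1 : ℝ))).sub (tendsto_id.const_div_atTop c)
    rw [show (1 : ℝ) = 1 ^ d by simp]
    refine (this.congr' ?_).pow d
    filter_upwards [eventually_gt_atTop 0] with r hr
    field_simp
  have h3 := h1.mul h2
  rw [mul_one] at h3
  refine tendsto_of_tendsto_of_tendsto_of_le_of_le' h3 (tendsto_card_ballSites_div_pow d) ?_ ?_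
  · filter_upwards [eventually_gt_atTop 0, eventually_gt_atTop c] with r hr hrc
    have hrc' : 0 < r - c := sub_pos.2 hrc
    simp only [Function.comp_apply, div_pow]
    rw [div_mul_div_cancel₀ (pow_pos hrc' d).ne']
    gcongr
    intro x hx
    rw [mem_ballSites] at hx
    refine mem_pairSites.2 ⟨hx.trans_le (by simp [c]), ?_⟩
    rw [sitePoint_add]
    linarith [norm_add_le (sitePoint x) (sitePoint z)]
  · filter_upwards [eventually_gt_atTop 0] with r hr
    gcongr
    exact Finset.filter_subset _ _

lemma tendsto_card_pairSites_div_volume {d : ℕ} (z : Site d) :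
    Tendsto (fun r : ℝ =>
      ((pairSites z r).card : ℝ) / (volume (Metric.ball (0 : RSpace d) r)).toReal) atTop (𝓝 1) := by
  have hv := volume_unitBall_pos d
  have h := (tendsto_card_pairSites_div_pow z).div_const
    (volume (Metric.ball (0 : RSpace d) 1)).toReal
  rw [div_self hv.ne'] at h
  refine h.congr' ?_
  filter_upwards [eventually_gt_atTop 0] with r hr
  rw [volume_ball_toReal hr, div_div]

/-- The radii `√m` are those at which the sets of sites change; the number of sites grows like
`m ^ (d / 2)`, fast enough for exponentially small probabilities to be summable. -/
lemma summable_exp_neg_card_pairSites {d : ℕ} (hd : 1 ≤ d) (z : Site d) {a : ℝ} (ha : 0 < a) :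
    Summable fun m : ℕ => Real.exp (-a * (pairSites z (√m)).card) := by
  have hv := volume_unitBall_pos d
  set v := (volume (Metric.ball (0 : RSpace d) 1)).toReal
  have hsqrt : Tendsto (fun m : ℕ => √(m : ℝ)) atTop atTop :=
    Real.tendsto_sqrt_atTop.comp tendsto_natCast_atTop_atTop
  have h1 := ((tendsto_card_pairSites_div_pow z).comp hsqrt).eventually
    (lt_mem_nhds (half_lt_self hv))
  have hs : Summable fun m : ℕ => 24 / (a * (v / 2)) ^ 4 * (1 / (m : ℝ) ^ 2) :=
    (Real.summable_one_div_nat_pow.2 one_lt_two).mul_left _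
  refine Summable.of_norm_bounded_eventually_nat hs ?_
  filter_upwards [h1, eventually_ge_atTop 1] with m hm hm1
  have hm1' : (1 : ℝ) ≤ m := by exact_mod_cast hm1
  have hs1 : 1 ≤ √(m : ℝ) := Real.one_le_sqrt.2 hm1'
  have hcard : v / 2 * √(m : ℝ) ≤ (pairSites z (√m)).card := by
    have := (lt_div_iff₀ (by positivity)).1 hm
    refine le_trans ?_ this.le
    gcongr
    exact le_self_pow₀ hs1 (by omega)
  -- It suffices to bound the exponential by its fourth-order Taylor term.
  have hexp := Real.pow_div_factorial_le_exp (a * (v / 2 * √(m : ℝ))) (by positivity) 4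
  rw [Real.norm_eq_abs, abs_of_pos (Real.exp_pos _)]
  calc Real.exp (-a * (pairSites z (√m)).card) ≤ Real.exp (-(a * (v / 2 * √(m : ℝ)))) := by
        refine Real.exp_le_exp.2 ?_
        nlinarith
    _ = (Real.exp (a * (v / 2 * √(m : ℝ))))⁻¹ := Real.exp_neg _
    _ ≤ ((a * (v / 2 * √(m : ℝ))) ^ 4 / (Nat.factorial 4 : ℕ))⁻¹ := by
        refine inv_anti₀ (by positivity) hexp
    _ = 24 / (a * (v / 2)) ^ 4 * (1 / (m : ℝ) ^ 2) := by
        have : √(m : ℝ) ^ 4 = (m : ℝ) ^ 2 := by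
          rw [show 4 = 2 * 2 from rfl, pow_mul, Real.sq_sqrt (by positivity)]
        rw [inv_div, ← mul_assoc, mul_pow, this]
        simp only [Nat.factorial]
        push_cast
        field_simp

/-! ### The autocorrelation -/

/-- A weighted Dirac comb on the lattice has only finitely many points in a ball. -/
lemma restrict_sum_smul_dirac_ball {d : ℕ} (w : Site d → ℝ≥0∞) (r : ℝ) :
    (Measure.sum fun x : Site d => w x • Measure.dirac (sitePoint x)).restrict
        (Metric.ball (0 : RSpace d) r) =
      ∑ x ∈ ballSites d r, w x • Measure.dirac (sitePoint x) := by
  classical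
  rw [Measure.restrict_sum _ measurableSet_ball]
  ext A hA
  rw [Measure.sum_apply _ hA, Measure.finsetSum_apply, tsum_eq_sum (s := ballSites d r)]
  · refine Finset.sum_congr rfl fun x hx => ?_
    rw [Measure.restrict_smul, restrict_dirac' measurableSet_ball,
      if_pos (by simpa using mem_ballSites.1 hx)]
  · intro x hx
    rw [Measure.restrict_smul, restrict_dirac' measurableSet_ball,
      if_neg (by simpa [mem_ballSites] using hx)]
    simp

lemma isLocallyFiniteMeasure_sum_smul_dirac {d : ℕ} {w : Site d → ℝ≥0∞} (hw : ∀ x, w x ≠ ⊤) :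
    IsLocallyFiniteMeasure (Measure.sum fun x : Site d => w x • Measure.dirac (sitePoint x)) := by
  refine ⟨fun y => ⟨Metric.ball 0 (‖y‖ + 1), Metric.isOpen_ball.mem_nhds (by simp), ?_⟩⟩
  rw [← Measure.restrict_apply_univ, restrict_sum_smul_dirac_ball, Measure.finsetSum_apply]
  refine ENNReal.sum_lt_top.2 fun x _ => ?_
  simpa using (hw x).lt_top

instance {d : ℕ} (μ : Measure (SpinConfig d)) : IsLocallyFiniteMeasure (correlationMeasure μ) :=
  isLocallyFiniteMeasure_sum_smul_dirac fun _ => ENNReal.ofReal_ne_top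

instance {d : ℕ} (σ : SpinConfig d) : IsLocallyFiniteMeasure (particleMeasure σ) :=
  isLocallyFiniteMeasure_sum_smul_dirac fun _ => ENNReal.ofReal_ne_top

lemma integral_restrict_particleMeasure {d : ℕ} (σ : SpinConfig d) (r : ℝ) {f : RSpace d → ℝ}
    (hf : Continuous f) : ∫ x, f x ∂(particleMeasure σ).restrict (Metric.ball 0 r) =
      ∑ x ∈ ballSites d r, occupation σ x * f (sitePoint x) := by
  rw [particleMeasure, restrict_sum_smul_dirac_ball, integral_finsetSum_measure]
  · refine Finset.sum_congr rfl fun x _ => ?_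
    rw [integral_smul_measure, integral_dirac' _ _ hf.stronglyMeasurable, smul_eq_mul,
      ENNReal.toReal_ofReal (occupation_mem_Icc σ x).1]
  · intro x _
    exact (integrable_dirac' hf.stronglyMeasurable (by simp)).smul_measure ENNReal.ofReal_ne_top

lemma integral_finiteAutocorrelation {d : ℕ} (σ : SpinConfig d) (r : ℝ) {f : RSpace d → ℝ}
    (hf : Continuous f) (hfc : HasCompactSupport f) :
    ∫ x, f x ∂finiteAutocorrelation (particleMeasure σ) r =
      (volume (Metric.ball (0 : RSpace d) r)).toReal⁻¹ *
        ∑ x ∈ ballSites d r, ∑ y ∈ ballSites d r,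
          occupation σ x * occupation σ y * f (sitePoint (x - y)) := by
  set ω := (particleMeasure σ).restrict (Metric.ball 0 r) with hω
  have : IsFiniteMeasure ω := isFiniteMeasure_restrict.2 measure_ball_lt_top.ne
  have hneg : Measurable fun x : RSpace d => -x := measurable_neg
  have hfin : IsFiniteMeasure (ω.map fun x => -x) := Measure.isFiniteMeasure_map _ _
  obtain ⟨C, hC⟩ := hfc.exists_bound_of_continuous hf
  have hadd : Continuous fun p : RSpace d × RSpace d => f (p.1 + p.2) := hf.comp continuous_add
  have hint : Integrable (fun p : RSpace d × RSpace d => f (p.1 + p.2))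
      (ω.prod (ω.map fun x => -x)) :=
    Integrable.of_bound hadd.aestronglyMeasurable C (ae_of_all _ fun p => hC _)
  rw [finiteAutocorrelation, integral_smul_measure, ENNReal.toReal_inv, smul_eq_mul]
  congr 1
  rw [Measure.conv, integral_map (by fun_prop) hf.aestronglyMeasurable, integral_prod _ hint]
  have h1 (x : RSpace d) : ∫ y, f (x + y) ∂(ω.map fun x => -x) =
      ∑ y ∈ ballSites d r, occupation σ y * f (x - sitePoint y) := by
    rw [integral_map hneg.aemeasurable (by fun_prop), hω,
      integral_restrict_particleMeasure σ r (f := fun y => f (x + -y)) (by fun_prop)]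
    simp only [sub_eq_add_neg]
  simp_rw [h1]
  rw [hω, integral_restrict_particleMeasure σ r (by fun_prop)]
  refine Finset.sum_congr rfl fun x _ => ?_
  rw [Finset.mul_sum]
  refine Finset.sum_congr rfl fun y _ => ?_
  rw [sitePoint_sub]
  ring

/-- Sorting the pairs of points by their difference. -/
lemma sum_ballSites_sub {d : ℕ} (n : Site d → ℝ) (h : Site d → ℝ) (Z : Finset (Site d))
    (hZ : ∀ z, z ∉ Z → h z = 0) (r : ℝ) :
    ∑ x ∈ ballSites d r, ∑ y ∈ ballSites d r, n x * n y * h (x - y) =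
      ∑ z ∈ Z, h z * ∑ y ∈ pairSites z r, n y * n (y + z) := by
  classical
  rw [← Finset.sum_product',
    ← Finset.sum_filter_of_ne (p := fun p : Site d × Site d => p.1 - p.2 ∈ Z)]
  · rw [← Finset.sum_fiberwise_of_maps_to (t := Z) (g := fun p : Site d × Site d => p.1 - p.2)
      (fun p hp => (Finset.mem_filter.1 hp).2)]
    refine Finset.sum_congr rfl fun z hz => ?_
    rw [Finset.mul_sum]
    refine Finset.sum_nbij' (fun p => p.2) (fun y => (y + z, y)) ?_ ?_ ?_ ?_ ?_
    · rintro ⟨x, y⟩ hp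
      simp only [Finset.mem_filter, Finset.mem_product, mem_ballSites] at hp
      obtain ⟨⟨⟨hx, hy⟩, -⟩, rfl⟩ := hp
      simpa [mem_pairSites] using ⟨hy, hx⟩
    · intro y hy
      rw [mem_pairSites] at hy
      simp [mem_ballSites, hy.1, hy.2, hz]
    · rintro ⟨x, y⟩ hp
      simp only [Finset.mem_filter] at hp
      simp [← hp.2]
    · intro y _
      rfl
    · rintro ⟨x, y⟩ hp
      simp only [Finset.mem_filter] at hp
      obtain ⟨-, rfl⟩ := hp
      simp
      ring
  · rintro ⟨x, y⟩ - hne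
    by_contra hcon
    exact hne (by simp [hZ _ hcon])

/-- Almost surely the averages over balls of the products `n_x n_{x+z}` converge, along all real
radii and for all `z`. -/
lemma ae_tendsto_pairSites_average {d : ℕ} (hd : 1 ≤ d) {J : Site d → ℝ}
    (hJ : Summable fun x => |J x|) {β : ℝ} {μ : Measure (SpinConfig d)}
    (hμ : IsGibbsMeasure J β μ)
    (hunique : ∀ μ' : Measure (SpinConfig d), IsGibbsMeasure J β μ' → μ' = μ) :
    ∀ᵐ σ ∂μ, ∀ z : Site d, Tendsto (fun r : ℝ => (volume (Metric.ball (0 : RSpace d) r)).toReal⁻¹ *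
      ∑ y ∈ pairSites z r, occupation σ y * occupation σ (y + z)) atTop
        (𝓝 (densityCorrelation μ z)) := by
  have := hμ.isProbabilityMeasure
  refine ae_all_iff.2 fun z => ?_
  set f : SpinConfig d → ℝ := fun σ => occupation σ 0 * occupation σ z with hf
  have hfc : Continuous f := (continuous_occupation 0).mul (continuous_occupation z)
  have hf01 (σ) : f σ ∈ Set.Icc (0 : ℝ) 1 := by
    have h0 := occupation_mem_Icc σ 0
    have h1 := occupation_mem_Icc σ z
    exact ⟨mul_nonneg h0.1 h1.1, mul_le_one₀ h0.2 h1.1 h1.2⟩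
  have hI : ∫ σ, f σ ∂μ ∈ Set.Icc (0 : ℝ) 1 := by
    refine ⟨integral_nonneg fun σ => (hf01 σ).1, ?_⟩
    have := integral_mono (integrable_of_continuous (μ := μ) hfc) (integrable_const 1)
      fun σ => (hf01 σ).2
    simpa using this
  have hdep : DependsOn f (({0, z} : Finset (Site d)) : Set (Site d)) := by
    intro σ σ' h
    have h0 := h 0 (by simp)
    have h1 := h z (by simp)
    simp only [hf, occupation, spin, h0, h1]
  have h1 := ae_tendsto_average_shift hJ hμ hunique hfc (fun σ => abs_le.2
    ⟨by linarith [(hf01 σ).1, hI.2], by linarith [(hf01 σ).2, hI.1]⟩) hdep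
    (fun m => pairSites z (√m)) fun a ha => summable_exp_neg_card_pairSites hd z ha
  filter_upwards [h1] with σ hσ
  have hceil : Tendsto (fun r : ℝ => ⌈r ^ 2⌉₊) atTop atTop :=
    tendsto_nat_ceil_atTop.comp (tendsto_pow_atTop two_ne_zero)
  have h2 := ((hσ.comp hceil).mul (tendsto_card_pairSites_div_volume z)).add
    ((tendsto_card_pairSites_div_volume z).const_mul (densityCorrelation μ z))
  rw [zero_mul, zero_add, mul_one] at h2
  refine h2.congr' ?_
  filter_upwards [eventually_gt_atTop 0] with r hr
  simp only [Function.comp_apply]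
  rw [pairSites_sqrt_ceil z hr, Finset.sum_sub_distrib, Finset.sum_const, nsmul_eq_mul]
  have hfs : ∑ x ∈ pairSites z r, f (shift x σ) =
      ∑ y ∈ pairSites z r, occupation σ y * occupation σ (y + z) := by
    simp [hf, add_comm]
  rw [hfs, show ∫ σ, f σ ∂μ = densityCorrelation μ z from rfl]
  rcases (pairSites z r).eq_empty_or_nonempty with h | h
  · simp [h]
  · have hpos : (0 : ℝ) < (pairSites z r).card := by exact_mod_cast h.card_pos
    rw [div_mul_div_cancel₀ hpos.ne']
    ring

/-- The autocorrelation of almost every configuration. -/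
theorem ae_isAutocorrelation {d : ℕ} (hd : 1 ≤ d) {J : Site d → ℝ}
    (hJ : Summable fun x => |J x|) {β : ℝ} {μ : Measure (SpinConfig d)}
    (hμ : IsGibbsMeasure J β μ)
    (hunique : ∀ μ' : Measure (SpinConfig d), IsGibbsMeasure J β μ' → μ' = μ) :
    ∀ᵐ σ ∂μ, IsAutocorrelation (particleMeasure σ) (correlationMeasure μ) := by
  filter_upwards [ae_tendsto_pairSites_average hd hJ hμ hunique] with σ hσ
  refine ⟨inferInstance, fun f hf hfc => ?_⟩
  obtain ⟨R, hR⟩ := hfc.isCompact.isBounded.subset_ball (0 : RSpace d)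
  have hZ (z : Site d) (hz : z ∉ ballSites d R) : f (sitePoint z) = 0 := by
    by_contra h
    have := hR (subset_tsupport f h)
    exact hz (mem_ballSites.2 (by simpa using this))
  have hlim : ∫ x, f x ∂correlationMeasure μ =
      ∑ z ∈ ballSites d R, f (sitePoint z) * densityCorrelation μ z := by
    rw [correlationMeasure, integral_sum_dirac fun _ => ENNReal.ofReal_ne_top,
      tsum_eq_sum (s := ballSites d R)]
    · refine Finset.sum_congr rfl fun z _ => ?_
      rw [ENNReal.toReal_ofReal, smul_eq_mul, mul_comm]
      exact integral_nonneg fun σ =>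
        mul_nonneg (occupation_mem_Icc σ 0).1 (occupation_mem_Icc σ z).1
    · intro z hz
      rw [hZ z hz, smul_zero]
  rw [hlim]
  have h1 := tendsto_finsetSum (ballSites d R) fun z _ => (hσ z).const_mul (f (sitePoint z))
  refine h1.congr fun r => ?_
  rw [integral_finiteAutocorrelation σ r hf hfc,
    sum_ballSites_sub (occupation σ) (fun z => f (sitePoint z)) (ballSites d R) hZ, Finset.mul_sum]
  exact Finset.sum_congr rfl fun z _ => by ring

/-! ### Poisson summation on the integer lattice -/

lemma summable_norm_sitePoint_rpow {d : ℕ} {p : ℝ} (hp : d < p) :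
    Summable fun x : Site d => ‖sitePoint x‖ ^ (-p) := by
  set b := (EuclideanSpace.basisFun (Fin d) ℝ).toBasis
  set L : Submodule ℤ (RSpace d) := Submodule.span ℤ (Set.range b)
  have hrank : Module.finrank ℤ L = d := by
    rw [ZLattice.rank ℝ L]
    simp
  have hmem (x : Site d) : sitePoint x ∈ L :=
    (Module.Basis.mem_span_iff_repr_mem ℤ b _).2 fun i => ⟨x i, by simp [b, sitePoint]⟩
  have h := ZLattice.summable_norm_rpow (L := L) (-p) (by rw [hrank]; linarith)
  exact h.comp_injective (i := fun x : Site d => (⟨sitePoint x, hmem x⟩ : L)) fun x y hxy =>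
    sitePoint_injective (congrArg Subtype.val hxy)

lemma summable_one_add_norm_sitePoint_pow (d : ℕ) :
    Summable fun x : Site d => ((1 + ‖sitePoint x‖) ^ (d + 1))⁻¹ := by
  have h := summable_norm_sitePoint_rpow (d := d) (p := ((d + 1 : ℕ) : ℝ)) (by push_cast; linarith)
  refine Summable.of_norm_bounded_eventually h ?_
  filter_upwards [(Set.finite_singleton (0 : Site d)).compl_mem_cofinite] with x hx
  have hx0 : 0 < ‖sitePoint x‖ := by
    rw [norm_pos_iff]
    intro h0
    exact hx (sitePoint_injective (h0.trans (by ext i; simp [sitePoint])))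
  rw [Real.norm_of_nonneg (by positivity), Real.rpow_neg hx0.le, Real.rpow_natCast]
  gcongr
  linarith

/-- A Schwartz function is dominated on all lattice translates, uniformly on balls. -/
lemma SchwartzMap.exists_norm_add_sitePoint_le {d : ℕ} (φ : 𝓢(RSpace d, ℂ)) (R : ℝ) :
    ∃ C : ℝ, ∀ (y : RSpace d) (k : Site d), ‖y‖ ≤ R →
      ‖φ (y + sitePoint k)‖ ≤ C * ((1 + ‖sitePoint k‖) ^ (d + 1))⁻¹ := by
  set A : ℝ := 2 ^ (d + 1) * (Finset.Iic (d + 1, 0)).sup (fun m => SchwartzMap.seminorm ℂ m.1 m.2) φ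
  have hA (v : RSpace d) : (1 + ‖v‖) ^ (d + 1) * ‖φ v‖ ≤ A := by
    have := SchwartzMap.one_add_le_sup_seminorm_apply (𝕜 := ℂ) (m := (d + 1, 0)) le_rfl le_rfl φ v
    simpa using this
  refine ⟨A * (1 + R) ^ (d + 1), fun y k hy => ?_⟩
  have hR : 0 ≤ R := (norm_nonneg y).trans hy
  have hk : 1 + ‖sitePoint k‖ ≤ (1 + ‖y + sitePoint k‖) * (1 + R) := by
    have h1 : ‖sitePoint k‖ ≤ ‖y + sitePoint k‖ + ‖y‖ := by
      simpa using norm_sub_le (y + sitePoint k) y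
    nlinarith [norm_nonneg (y + sitePoint k)]
  rw [← div_eq_mul_inv, le_div_iff₀ (by positivity)]
  calc ‖φ (y + sitePoint k)‖ * (1 + ‖sitePoint k‖) ^ (d + 1)
      ≤ ‖φ (y + sitePoint k)‖ * ((1 + ‖y + sitePoint k‖) * (1 + R)) ^ (d + 1) := by gcongr
    _ = ((1 + ‖y + sitePoint k‖) ^ (d + 1) * ‖φ (y + sitePoint k)‖) * (1 + R) ^ (d + 1) := by
        rw [mul_pow]; ring
    _ ≤ A * (1 + R) ^ (d + 1) := by gcongr; exact hA _

lemma SchwartzMap.summable_norm_sitePoint {d : ℕ} (φ : 𝓢(RSpace d, ℂ)) :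
    Summable fun k : Site d => ‖φ (sitePoint k)‖ := by
  obtain ⟨C, hC⟩ := φ.exists_norm_add_sitePoint_le 0
  refine Summable.of_nonneg_of_le (fun _ => norm_nonneg _) (fun k => ?_)
    ((summable_one_add_norm_sitePoint_pow d).mul_left C)
  simpa using hC 0 k (by simp)

/-- The periodization `y ↦ ∑ k, φ (y + k)`. -/
noncomputable def periodization {d : ℕ} (φ : 𝓢(RSpace d, ℂ)) (y : RSpace d) : ℂ :=
  ∑' k : Site d, φ (y + sitePoint k)

lemma hasSum_periodization {d : ℕ} (φ : 𝓢(RSpace d, ℂ)) (y : RSpace d) :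
    HasSum (fun k : Site d => φ (y + sitePoint k)) (periodization φ y) := by
  obtain ⟨C, hC⟩ := φ.exists_norm_add_sitePoint_le ‖y‖
  exact (Summable.of_norm_bounded ((summable_one_add_norm_sitePoint_pow d).mul_left C)
    fun k => hC y k le_rfl).hasSum

lemma continuous_periodization {d : ℕ} (φ : 𝓢(RSpace d, ℂ)) : Continuous (periodization φ) := by
  refine continuous_iff_continuousAt.2 fun y => ?_
  obtain ⟨C, hC⟩ := φ.exists_norm_add_sitePoint_le (‖y‖ + 1)
  have h : ContinuousOn (periodization φ) (Metric.ball 0 (‖y‖ + 1)) :=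
    continuousOn_tsum (fun k => (φ.continuous.comp (continuous_add_const _)).continuousOn)
      ((summable_one_add_norm_sitePoint_pow d).mul_left C)
      fun k v hv => hC v k (by simpa using (mem_ball_zero_iff.1 hv).le)
  exact h.continuousAt (Metric.isOpen_ball.mem_nhds (by simp))

lemma periodization_add_sitePoint {d : ℕ} (φ : 𝓢(RSpace d, ℂ)) (y : RSpace d) (n : Site d) :
    periodization φ (y + sitePoint n) = periodization φ y := by
  unfold periodization
  rw [← (Equiv.addLeft n).tsum_eq (fun k => φ (y + sitePoint k))]
  refine tsum_congr fun k => ?_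
  rw [Equiv.coe_addLeft, sitePoint_add, add_assoc]

/-- The periodization descends to a continuous function on the torus. -/
lemma exists_continuousMap_periodization {d : ℕ} (φ : 𝓢(RSpace d, ℂ)) :
    ∃ f : C(UnitAddTorus (Fin d), ℂ), ∀ y : Fin d → ℝ,
      f (fun i => (y i : UnitAddCircle)) = periodization φ (WithLp.toLp 2 y) := by
  set π : (Fin d → ℝ) → UnitAddTorus (Fin d) := Pi.map fun _ => QuotientAddGroup.mk with hπ
  have hq : IsOpenQuotientMap π :=
    IsOpenQuotientMap.piMap fun _ => QuotientAddGroup.isOpenQuotientMap_mk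
  choose s hs using hq.surjective
  have hf (y : Fin d → ℝ) : periodization φ (WithLp.toLp 2 (s (π y))) =
      periodization φ (WithLp.toLp 2 y) := by
    have h1 (i : Fin d) : ∃ n : ℤ, s (π y) i = y i + n := by
      have h2 : ((s (π y) i : ℝ) : UnitAddCircle) = (y i : UnitAddCircle) := congrFun (hs (π y)) i
      obtain ⟨n, hn⟩ := AddSubgroup.mem_zmultiples_iff.1 (QuotientAddGroup.eq_iff_sub_mem.1 h2)
      exact ⟨n, by rw [zsmul_one] at hn; linarith⟩
    choose n hn using h1
    have h3 : (WithLp.toLp 2 (s (π y)) : RSpace d) = WithLp.toLp 2 y + sitePoint n := by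
      ext i
      simp [sitePoint, hn]
    rw [h3, periodization_add_sitePoint]
  have hcont : Continuous fun t => periodization φ (WithLp.toLp 2 (s t)) := by
    rw [← hq.continuous_comp_iff]
    refine ((continuous_periodization φ).comp (PiLp.continuous_toLp 2 _)).congr fun y => (hf y).symm
  exact ⟨⟨_, hcont⟩, hf⟩

/-- The unit cube with lower corner `k`, open at its lower faces. -/
def latticeCube {d : ℕ} (k : Site d) : Set (Fin d → ℝ) :=
  {x | ∀ i, x i ∈ Set.Ioc (k i : ℝ) (k i + 1)}

lemma measurableSet_latticeCube {d : ℕ} (k : Site d) : MeasurableSet (latticeCube k) :=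
  MeasurableSet.univ_pi' fun _ => measurableSet_Ioc

lemma mem_latticeCube_iff {d : ℕ} {k : Site d} {x : Fin d → ℝ} :
    x ∈ latticeCube k ↔ k = fun i => ⌈x i⌉ - 1 := by
  simp only [latticeCube, Set.mem_ofPred_eq, Set.mem_Ioc, funext_iff, eq_sub_iff_add_eq]
  refine forall_congr' fun i => ?_
  rw [eq_comm, Int.ceil_eq_iff]
  push_cast
  rw [add_sub_cancel_right]

/-- The integral over the whole space is the sum of the integrals over the unit cubes. -/
lemma hasSum_integral_latticeCube {d : ℕ} {h : (Fin d → ℝ) → ℂ} (hh : Integrable h) :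
    HasSum (fun k : Site d => ∫ x in latticeCube (0 : Site d), h (x + fun i => (k i : ℝ)))
      (∫ x, h x) := by
  have hunion : ⋃ k : Site d, latticeCube k = Set.univ :=
    Set.eq_univ_of_forall fun x => Set.mem_iUnion.2 ⟨_, mem_latticeCube_iff.2 rfl⟩
  have h1 := hasSum_integral_iUnion (μ := volume) (f := h) (measurableSet_latticeCube (d := d))
    (fun k l hkl => Set.disjoint_left.2 fun x hk hl =>
      hkl ((mem_latticeCube_iff.1 hk).trans (mem_latticeCube_iff.1 hl).symm)) hh.integrableOn
  rw [hunion, setIntegral_univ] at h1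
  refine h1.congr_fun fun k => ?_
  have hpre : (fun x : Fin d → ℝ => x + fun i => (k i : ℝ)) ⁻¹' latticeCube k =
      latticeCube (0 : Site d) := by
    ext x
    refine forall_congr' fun i => ?_
    simp only [Pi.add_apply, Set.mem_Ioc, Pi.zero_apply, Int.cast_zero]
    constructor <;> rintro ⟨h1, h2⟩ <;> constructor <;> linarith
  rw [← hpre]
  exact (measurePreserving_add_right volume _).setIntegral_preimage_emb
    (measurableEmbedding_addRight _) h _

open scoped RealInnerProductSpace in
/-- The Poisson summation formula for Schwartz functions and the lattice `ℤ^d`: the Fourier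
coefficients of the periodization are the values of the Fourier transform at the lattice points, and
the Fourier series of the periodization is evaluated at the origin. -/
theorem hasSum_fourier_sitePoint {d : ℕ} (φ : 𝓢(RSpace d, ℂ)) :
    HasSum (fun n : Site d => 𝓕 (φ : RSpace d → ℂ) (sitePoint n))
      (∑' k : Site d, φ (sitePoint k)) := by
  obtain ⟨f, hf⟩ := exists_continuousMap_periodization φ
  have hcoeff (n : Site d) :
      UnitAddTorus.mFourierCoeff f n = 𝓕 (φ : RSpace d → ℂ) (sitePoint n) := by
    set e : RSpace d → ℂ := fun v =>
      Complex.exp (↑(-2 * Real.pi * ⟪v, sitePoint n⟫) * Complex.I) with he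
    have hemF (x : Fin d → ℝ) :
        UnitAddTorus.mFourier (-n) (fun i => (x i : UnitAddCircle)) = e (WithLp.toLp 2 x) := by
      simp only [UnitAddTorus.mFourier, ContinuousMap.coe_mk, fourier_coe_apply, he,
        ← Complex.exp_sum]
      congr 1
      simp only [EuclideanSpace.inner_eq_star_dotProduct, dotProduct, sitePoint]
      push_cast
      rw [Finset.mul_sum, Finset.sum_mul]
      refine Finset.sum_congr rfl fun i _ => ?_
      simp
      ring
    have hper (v : RSpace d) (k : Site d) : e (v + sitePoint k) = e v := by
      simp only [he]
      rw [inner_add_left]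
      have h1 : (⟪sitePoint k, sitePoint n⟫ : ℝ) = ((∑ i, n i * k i : ℤ) : ℝ) := by
        simp [EuclideanSpace.inner_eq_star_dotProduct, dotProduct, sitePoint]
      rw [h1, Complex.exp_eq_exp_iff_exists_int]
      refine ⟨-∑ i, n i * k i, ?_⟩
      push_cast
      ring
    have hec : Continuous e := by
      simp only [he]
      fun_prop
    have hnorm (v : RSpace d) : ‖e v‖ = 1 := Complex.norm_exp_ofReal_mul_I _
    have hmp := (EuclideanSpace.volume_preserving_symm_measurableEquiv_toLp (Fin d)).symm
    have hint : Integrable fun v : RSpace d => e v * φ v :=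
      (φ.integrable (μ := volume)).bdd_mul hec.aestronglyMeasurable
        (ae_of_all _ fun v => (hnorm v).le)
    have hint' : Integrable fun x : Fin d → ℝ => e (WithLp.toLp 2 x) * φ (WithLp.toLp 2 x) :=
      (hmp.integrable_comp_emb (MeasurableEquiv.measurableEmbedding _)).2 hint
    have htotal : 𝓕 (φ : RSpace d → ℂ) (sitePoint n) =
        ∫ x : Fin d → ℝ, e (WithLp.toLp 2 x) * φ (WithLp.toLp 2 x) := by
      rw [Real.fourier_eq']
      exact (hmp.integral_comp (MeasurableEquiv.measurableEmbedding _) _).symm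
    -- The integral over the space and the integral of the periodization over the unit cube are
    -- sums of the same integrals over the unit cube.
    have hcube := hasSum_integral_latticeCube hint'
    rw [← htotal] at hcube
    obtain ⟨R, hR⟩ : ∃ R, ∀ x ∈ latticeCube (0 : Site d), ‖(WithLp.toLp 2 x : RSpace d)‖ ≤ R := by
      refine ⟨√(∑ _i : Fin d, 1), fun x hx => ?_⟩
      rw [EuclideanSpace.norm_eq]
      refine Real.sqrt_le_sqrt (Finset.sum_le_sum fun i _ => ?_)
      have := hx i
      simp only [Pi.zero_apply, Int.cast_zero, zero_add, Set.mem_Ioc] at this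
      simpa [abs_le] using ⟨by linarith [this.1], this.2⟩
    obtain ⟨C, hC⟩ := φ.exists_norm_add_sitePoint_le R
    have hvol : IsFiniteMeasure (volume.restrict (latticeCube (0 : Site d))) := by
      refine isFiniteMeasure_restrict.2 ?_
      have : latticeCube (0 : Site d) = Set.univ.pi fun _ => Set.Ioc (0 : ℝ) 1 := by
        ext x; simp [latticeCube]
      rw [this, Real.volume_pi_Ioc]
      simp
    have hdom : HasSum (fun k : Site d => ∫ x in latticeCube (0 : Site d),
        e (WithLp.toLp 2 (x + fun i => (k i : ℝ))) * φ (WithLp.toLp 2 (x + fun i => (k i : ℝ))))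
        (∫ x in latticeCube (0 : Site d),
          e (WithLp.toLp 2 x) * periodization φ (WithLp.toLp 2 x)) := by
      have hadd (x : Fin d → ℝ) (k : Site d) : (WithLp.toLp 2 (x + fun i => (k i : ℝ)) : RSpace d) =
        WithLp.toLp 2 x + sitePoint k := rfl
      simp only [hadd, hper]
      have hto : Continuous (WithLp.toLp 2 : (Fin d → ℝ) → RSpace d) := PiLp.continuous_toLp 2 _
      refine hasSum_integral_of_dominated_convergence
        (fun k _ => C * ((1 + ‖sitePoint k‖) ^ (d + 1))⁻¹) (fun k => ?_) (fun k => ?_)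
        (ae_of_all _ fun _ => (summable_one_add_norm_sitePoint_pow d).mul_left C)
        (integrable_const _) (ae_of_all _ fun x => (hasSum_periodization φ _).mul_left _)
      · exact ((hec.comp hto).mul
          (φ.continuous.comp (hto.add continuous_const))).aestronglyMeasurable
      · refine (ae_restrict_iff' (measurableSet_latticeCube 0)).2 (ae_of_all _ fun x hx => ?_)
        rw [norm_mul, hnorm, one_mul]
        exact hC _ k (hR x hx)
    rw [hcube.unique hdom, UnitAddTorus.mFourierCoeff_eq_integral f n 0]
    have hset : {x : Fin d → ℝ | ∀ i, x i ∈ Set.Ioc ((0 : Fin d → ℝ) i) ((0 : Fin d → ℝ) i + 1)} =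
        latticeCube (0 : Site d) := by
      simp [latticeCube]
    rw [hset]
    simp only [hf, hemF, smul_eq_mul]
  have hsum : Summable (UnitAddTorus.mFourierCoeff f) := by
    have h1 := (𝓕 φ).summable_norm_sitePoint
    rw [funext hcoeff]
    exact h1.of_norm
  have h2 := UnitAddTorus.hasSum_mFourier_series_apply_of_summable hsum 0
  have h0 : f 0 = ∑' k : Site d, φ (sitePoint k) := by
    have h3 := hf 0
    simp only [Pi.zero_apply, WithLp.toLp_zero, periodization, zero_add] at h3
    exact h3
  rw [h0] at h2
  refine h2.congr_fun fun n => ?_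
  have h1 : UnitAddTorus.mFourier n (0 : UnitAddTorus (Fin d)) = 1 := by
    simp [UnitAddTorus.mFourier]
  rw [h1, smul_eq_mul, mul_one, hcoeff]

/-! ### The diffraction density -/

lemma abs_spinCorrelation_le {d : ℕ} (μ : Measure (SpinConfig d)) [IsProbabilityMeasure μ]
    (x : Site d) : |spinCorrelation μ x| ≤ 1 := by
  refine (norm_integral_le_of_norm_le_const (μ := μ) (C := 1)
    (f := fun σ => spin σ 0 * spin σ x) (ae_of_all _ fun σ => ?_)).trans (by simp)
  rw [Real.norm_eq_abs, abs_mul, abs_spin, abs_spin, one_mul]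

lemma integral_spin_mul_spin {d : ℕ} {μ : Measure (SpinConfig d)}
    (hshift : ∀ a : Site d, μ.map (shift a) = μ) (x y : Site d) :
    ∫ σ, spin σ x * spin σ y ∂μ = spinCorrelation μ (y - x) := by
  have hm : Continuous fun σ : SpinConfig d => spin σ 0 * spin σ (y - x) :=
    (continuous_spin 0).mul (continuous_spin (y - x))
  unfold spinCorrelation
  conv_rhs => rw [← hshift x]
  rw [integral_map (continuous_shift x).measurable.aemeasurable hm.measurable.aestronglyMeasurable]
  simp

lemma spinCorrelation_neg {d : ℕ} {μ : Measure (SpinConfig d)}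
    (hshift : ∀ a : Site d, μ.map (shift a) = μ) (x : Site d) :
    spinCorrelation μ (-x) = spinCorrelation μ x := by
  have h1 := integral_spin_mul_spin hshift x 0
  rw [zero_sub] at h1
  rw [← h1]
  simp_rw [mul_comm (spin _ x)]
  rfl

/-- Both decay hypotheses make the correlations summable. -/
lemma summable_spinCorrelation {d : ℕ} {μ : Measure (SpinConfig d)}
    (hdecay :
      (∃ C ε : ℝ, 0 < C ∧ 0 < ε ∧
        ∀ x : Site d, |spinCorrelation μ x| ≤ C * Real.exp (-ε * ‖sitePoint x‖)) ∨
      (∃ C p : ℝ, 0 < C ∧ (d : ℝ) < p ∧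
        ∀ x : Site d, x ≠ 0 → |spinCorrelation μ x| ≤ C * ‖sitePoint x‖ ^ (-p))) :
    Summable (spinCorrelation μ) := by
  rcases hdecay with ⟨C, ε, hC, hε, h⟩ | ⟨C, p, hC, hp, h⟩
  · have hs := (summable_one_add_norm_sitePoint_pow d).mul_left
      (C * (Real.exp ε * ((d + 1).factorial / ε ^ (d + 1))))
    refine Summable.of_norm_bounded hs fun x => (h x).trans ?_
    rw [mul_assoc]
    refine mul_le_mul_of_nonneg_left ?_ hC.le
    have h1 := Real.pow_div_factorial_le_exp (ε * (1 + ‖sitePoint x‖)) (by positivity) (d + 1)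
    have h2 : Real.exp (-ε * ‖sitePoint x‖) =
        Real.exp ε * (Real.exp (ε * (1 + ‖sitePoint x‖)))⁻¹ := by
      rw [← Real.exp_neg, ← Real.exp_add]
      congr 1
      ring
    rw [h2, mul_assoc]
    refine mul_le_mul_of_nonneg_left ((inv_anti₀ (by positivity) h1).trans (le_of_eq ?_))
      (Real.exp_pos _).le
    rw [inv_div, mul_pow]
    field_simp
  · refine Summable.of_norm_bounded_eventually ((summable_norm_sitePoint_rpow hp).mul_left C) ?_
    filter_upwards [(Set.finite_singleton (0 : Site d)).compl_mem_cofinite] with x hx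
    exact h x hx

open scoped RealInnerProductSpace

/-- The density `¼ ∑_x ⟨σ_0 σ_x⟩ cos(2π⟨x, k⟩)` of the absolutely continuous part of the
diffraction spectrum. -/
noncomputable def diffractionDensity {d : ℕ} (μ : Measure (SpinConfig d)) (k : RSpace d) : ℝ :=
  (∑' x : Site d, spinCorrelation μ x * Real.cos (2 * Real.pi * ⟪sitePoint x, k⟫)) / 4

lemma abs_mul_cos_le (a b : ℝ) : |a * Real.cos b| ≤ |a| := by
  rw [abs_mul]
  exact mul_le_of_le_one_right (abs_nonneg _) (Real.abs_cos_le_one _)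

lemma summable_mul_cos {d : ℕ} {c : Site d → ℝ} (hc : Summable c) (θ : Site d → ℝ) :
    Summable fun x => c x * Real.cos (θ x) :=
  Summable.of_norm_bounded hc.abs fun _ => abs_mul_cos_le _ _

lemma continuous_diffractionDensity {d : ℕ} {μ : Measure (SpinConfig d)}
    (hc : Summable (spinCorrelation μ)) : Continuous (diffractionDensity μ) := by
  unfold diffractionDensity
  refine Continuous.div_const (continuous_tsum (fun x => ?_) hc.abs
    fun _ _ => abs_mul_cos_le _ _) _
  fun_prop

lemma inner_sitePoint {d : ℕ} (x n : Site d) :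
    ⟪sitePoint x, sitePoint n⟫ = ((∑ i, n i * x i : ℤ) : ℝ) := by
  simp [EuclideanSpace.inner_eq_star_dotProduct, dotProduct, sitePoint]

lemma diffractionDensity_add_sitePoint {d : ℕ} (μ : Measure (SpinConfig d)) (k : RSpace d)
    (n : Site d) : diffractionDensity μ (k + sitePoint n) = diffractionDensity μ k := by
  unfold diffractionDensity
  congr 1
  refine tsum_congr fun x => ?_
  rw [inner_add_right, inner_sitePoint, mul_add, mul_comm (2 * Real.pi) (Int.cast _),
    Real.cos_add_int_mul_two_pi]

lemma diffractionDensity_le {d : ℕ} {μ : Measure (SpinConfig d)}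
    (hc : Summable (spinCorrelation μ)) (k : RSpace d) :
    diffractionDensity μ k ≤ (∑' x, |spinCorrelation μ x|) / 4 := by
  unfold diffractionDensity
  gcongr
  · exact summable_mul_cos hc _
  · exact hc.abs
  · exact (le_abs_self _).trans (abs_mul_cos_le _ _)

/-- The finite-volume structure factor is nonnegative, being the mean of a squared modulus. -/
lemma sum_spinCorrelation_mul_cos_nonneg {d : ℕ} {μ : Measure (SpinConfig d)}
    [IsProbabilityMeasure μ] (hshift : ∀ a : Site d, μ.map (shift a) = μ) (k : RSpace d)
    (V : Finset (Site d)) :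
    0 ≤ ∑ x ∈ V, ∑ y ∈ V, spinCorrelation μ (x - y) *
      Real.cos (2 * Real.pi * ⟪sitePoint (x - y), k⟫) := by
  set θ : Site d → ℝ := fun x => 2 * Real.pi * ⟪sitePoint x, k⟫ with hθ
  have hi (x y : Site d) : Integrable (fun σ => spin σ x * spin σ y * Real.cos (θ x - θ y)) μ :=
    (integrable_of_continuous ((continuous_spin x).mul (continuous_spin y))).mul_const _
  have h1 : ∑ x ∈ V, ∑ y ∈ V, spinCorrelation μ (x - y) *
      Real.cos (2 * Real.pi * ⟪sitePoint (x - y), k⟫) =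
      ∫ σ, ∑ x ∈ V, ∑ y ∈ V, spin σ x * spin σ y * Real.cos (θ x - θ y) ∂μ := by
    rw [integral_finsetSum _ fun x _ => integrable_finsetSum _ fun y _ => hi x y]
    refine Finset.sum_congr rfl fun x _ => ?_
    rw [integral_finsetSum _ fun y _ => hi x y]
    refine Finset.sum_congr rfl fun y _ => ?_
    rw [integral_mul_const, integral_spin_mul_spin hshift, ← spinCorrelation_neg hshift, neg_sub,
      sitePoint_sub, inner_sub_left, mul_sub]
  rw [h1]
  refine integral_nonneg fun σ => ?_
  have h2 : ∑ x ∈ V, ∑ y ∈ V, spin σ x * spin σ y * Real.cos (θ x - θ y) =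
      (∑ x ∈ V, spin σ x * Real.cos (θ x)) ^ 2 + (∑ x ∈ V, spin σ x * Real.sin (θ x)) ^ 2 := by
    rw [sq, sq, Finset.sum_mul_sum, Finset.sum_mul_sum, ← Finset.sum_add_distrib]
    refine Finset.sum_congr rfl fun x _ => ?_
    rw [← Finset.sum_add_distrib]
    refine Finset.sum_congr rfl fun y _ => ?_
    rw [Real.cos_sub]
    ring
  show (0 : ℝ) ≤ _
  rw [h2]
  positivity

/-- The density is the limit of the finite-volume structure factors per site. -/
lemma diffractionDensity_nonneg {d : ℕ} {μ : Measure (SpinConfig d)}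
    [IsProbabilityMeasure μ] (hshift : ∀ a : Site d, μ.map (shift a) = μ)
    (hc : Summable (spinCorrelation μ)) (k : RSpace d) : 0 ≤ diffractionDensity μ k := by
  classical
  set h : Site d → ℝ := fun x => spinCorrelation μ x * Real.cos (2 * Real.pi * ⟪sitePoint x, k⟫)
  set v := fun r : ℝ => (volume (Metric.ball (0 : RSpace d) r)).toReal
  have hnonneg (r : ℝ) : 0 ≤ ∑' z, h z * ((pairSites z r).card / v r) := by
    have h1 := sum_spinCorrelation_mul_cos_nonneg hshift k (ballSites d r)
    set Z := (ballSites d r ×ˢ ballSites d r).image fun p => p.1 - p.2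
    have hZ (z : Site d) (hz : z ∉ Z) : (pairSites z r).card = 0 := by
      rw [Finset.card_eq_zero, Finset.eq_empty_iff_forall_notMem]
      intro x hx
      rw [mem_pairSites] at hx
      exact hz (Finset.mem_image.2 ⟨(x + z, x), Finset.mk_mem_product (mem_ballSites.2 hx.2)
        (mem_ballSites.2 hx.1), by simp⟩)
    have h2 := sum_ballSites_sub (fun _ => 1) (fun z => if z ∈ Z then h z else 0) Z
      (fun z hz => if_neg hz) r
    have h3 : ∑ x ∈ ballSites d r, ∑ y ∈ ballSites d r, h (x - y) =
        ∑ z ∈ Z, h z * (pairSites z r).card := by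
      convert! h2 using 1
      · refine Finset.sum_congr rfl fun x hx => Finset.sum_congr rfl fun y hy => ?_
        rw [if_pos (Finset.mem_image_of_mem _ (Finset.mk_mem_product hx hy))]
        ring
      · refine Finset.sum_congr rfl fun z hz => ?_
        simp [hz]
    rw [tsum_eq_sum (s := Z) fun z hz => by simp [hZ z hz]]
    simp_rw [← mul_div_assoc]
    rw [← Finset.sum_div, ← h3]
    exact div_nonneg h1 ENNReal.toReal_nonneg
  have hlim : Tendsto (fun r => ∑' z, h z * ((pairSites z r).card / v r)) atTop
      (𝓝 (∑' z, h z)) := by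
    refine tendsto_tsum_of_dominated_convergence (bound := fun z => |spinCorrelation μ z| * 2)
      (hc.abs.mul_right 2) (fun z => ?_) ?_
    · simpa using (tendsto_card_pairSites_div_volume z).const_mul (h z)
    · filter_upwards [(tendsto_card_pairSites_div_volume (0 : Site d)).eventually
        (gt_mem_nhds one_lt_two)] with r hr z
      rw [norm_mul]
      have hv : 0 ≤ v r := ENNReal.toReal_nonneg
      refine mul_le_mul (abs_mul_cos_le _ _) ?_ (norm_nonneg _) (abs_nonneg _)
      rw [Real.norm_of_nonneg (by positivity)]
      refine le_trans ?_ hr.le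
      refine div_le_div_of_nonneg_right ?_ hv
      refine Nat.cast_le.2 (Finset.card_le_card fun x hx => ?_)
      have := (mem_pairSites.1 hx).1
      simpa [mem_pairSites] using this
  exact div_nonneg (ge_of_tendsto' hlim hnonneg) (by norm_num)

/-! ### The diffraction spectrum -/

/-- The diffraction measure: a quarter of the lattice comb and an absolutely continuous part. -/
noncomputable def diffractionMeasure {d : ℕ} (μ : Measure (SpinConfig d)) : Measure (RSpace d) :=
  (1 / 4 : ℝ≥0∞) • latticeComb d +
    volume.withDensity fun k => ENNReal.ofReal (diffractionDensity μ k)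

lemma integrable_sum_smul_dirac_sitePoint {d : ℕ} (φ : 𝓢(RSpace d, ℂ)) {w : Site d → ℝ≥0∞}
    (hw : ∀ x, w x ≤ 1) :
    Integrable φ (Measure.sum fun x : Site d => w x • Measure.dirac (sitePoint x)) := by
  refine integrable_sum_dirac (fun x => ((hw x).trans_lt ENNReal.one_lt_top).ne) ?_
  refine Summable.of_nonneg_of_le (fun x => by positivity) (fun x => ?_) φ.summable_norm_sitePoint
  exact mul_le_of_le_one_left (norm_nonneg _)
    (ENNReal.toReal_le_of_le_ofReal zero_le_one (by simpa using hw x))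

lemma latticeComb_eq (d : ℕ) :
    latticeComb d = Measure.sum fun x : Site d => (1 : ℝ≥0∞) • Measure.dirac (sitePoint x) := by
  simp [latticeComb]

lemma isLatticePeriodic_diffractionMeasure {d : ℕ} {μ : Measure (SpinConfig d)}
    (hc : Summable (spinCorrelation μ)) : IsLatticePeriodic (diffractionMeasure μ) := by
  intro n
  have hm : Measurable fun x : RSpace d => x + sitePoint n := measurable_add_const _
  have h1 : (latticeComb d).map (fun x => x + sitePoint n) = latticeComb d := by
    ext A hA
    rw [Measure.map_apply hm hA, latticeComb, Measure.sum_apply _ (hm hA), Measure.sum_apply _ hA,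
      ← (Equiv.addRight n).tsum_eq fun k => Measure.dirac (sitePoint k) A]
    refine tsum_congr fun k => ?_
    rw [Measure.dirac_apply' _ (hm hA), Measure.dirac_apply' _ hA, Equiv.coe_addRight,
      sitePoint_add]
    rfl
  have h2 : (volume.withDensity fun k => ENNReal.ofReal (diffractionDensity μ k)).map
      (fun x => x + sitePoint n) =
      volume.withDensity fun k => ENNReal.ofReal (diffractionDensity μ k) := by
    ext A hA
    rw [Measure.map_apply hm hA, withDensity_apply _ (hm hA), withDensity_apply _ hA,
      ← (measurePreserving_add_right volume (sitePoint n)).setLIntegral_comp_preimage hA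
        (continuous_diffractionDensity hc).measurable.ennreal_ofReal]
    simp_rw [diffractionDensity_add_sitePoint]
  rw [diffractionMeasure, Measure.map_add _ _ hm, Measure.map_smul, h1, h2]

lemma isLebesgueDecomposition_diffractionMeasure {d : ℕ} (μ : Measure (SpinConfig d)) :
    IsLebesgueDecomposition (diffractionMeasure μ) ((1 / 4 : ℝ≥0∞) • latticeComb d)
      (volume.withDensity fun k => ENNReal.ofReal (diffractionDensity μ k)) 0 where
  eq_add := (add_zero _).symm
  purePoint := by
    refine ⟨Set.range sitePoint, Set.countable_range _, ?_⟩
    have hS : MeasurableSet (Set.range (sitePoint (d := d))) :=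
      (Set.countable_range _).measurableSet
    rw [Measure.smul_apply, latticeComb, Measure.sum_apply _ hS.compl]
    simp [Measure.dirac_apply' _ hS.compl]
  absolutelyContinuous := withDensity_absolutelyContinuous _ _
  sc_noAtoms := fun _ => rfl
  sc_singular := Measure.MutuallySingular.zero_left

/-- The Fourier series with coefficients `⟨σ_0 σ_x⟩` reduces to a cosine series, by symmetry. -/
lemma hasSum_spinCorrelation_mul_exp {d : ℕ} {μ : Measure (SpinConfig d)}
    (hshift : ∀ a : Site d, μ.map (shift a) = μ) (hc : Summable (spinCorrelation μ))
    (k : RSpace d) :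
    HasSum (fun x : Site d => (spinCorrelation μ x : ℂ) *
      Complex.exp (↑(-2 * Real.pi * ⟪k, sitePoint x⟫) * Complex.I))
      ((4 * diffractionDensity μ k : ℝ) : ℂ) := by
  set θ : Site d → ℝ := fun x => 2 * Real.pi * ⟪sitePoint x, k⟫ with hθ
  have hs : Summable fun x => spinCorrelation μ x * Real.sin (θ x) :=
    Summable.of_norm_bounded hc.abs fun x => by
      rw [Real.norm_eq_abs, abs_mul]
      exact mul_le_of_le_one_right (abs_nonneg _) (Real.abs_sin_le_one _)
  have hs0 : ∑' x, spinCorrelation μ x * Real.sin (θ x) = 0 := by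
    have h1 := (Equiv.neg (Site d)).tsum_eq fun x => spinCorrelation μ x * Real.sin (θ x)
    have h2 : ∀ x, spinCorrelation μ (Equiv.neg _ x) * Real.sin (θ (Equiv.neg _ x)) =
        -(spinCorrelation μ x * Real.sin (θ x)) := fun x => by
      rw [Equiv.neg_apply, spinCorrelation_neg hshift]
      simp [hθ, sitePoint_neg]
    rw [tsum_congr h2, tsum_neg] at h1
    linarith
  have hcos := (summable_mul_cos hc θ).hasSum
  have hsin := hs.hasSum
  rw [hs0] at hsin
  have h3 := (Complex.hasSum_ofReal.2 hcos).sub ((Complex.hasSum_ofReal.2 hsin).mul_right Complex.I)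
  rw [Complex.ofReal_zero, zero_mul, sub_zero] at h3
  have h4 : 4 * diffractionDensity μ k = ∑' x, spinCorrelation μ x * Real.cos (θ x) :=
    mul_div_cancel₀ _ (by norm_num)
  rw [h4]
  refine h3.congr_fun fun x => ?_
  have h5 : -2 * Real.pi * ⟪k, sitePoint x⟫ = -θ x := by
    rw [hθ, real_inner_comm]; ring
  rw [h5, Complex.exp_mul_I, ← Complex.ofReal_cos, ← Complex.ofReal_sin, Real.cos_neg, Real.sin_neg]
  push_cast
  ring

/-- Pairing the Fourier transform with the summable correlations. -/
lemma hasSum_spinCorrelation_mul_fourier {d : ℕ} {μ : Measure (SpinConfig d)}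
    (hshift : ∀ a : Site d, μ.map (shift a) = μ) (hc : Summable (spinCorrelation μ))
    (φ : 𝓢(RSpace d, ℂ)) :
    HasSum (fun x : Site d => (spinCorrelation μ x : ℂ) * 𝓕 (φ : RSpace d → ℂ) (sitePoint x))
      (4 * ∫ k, (diffractionDensity μ k : ℂ) * φ k) := by
  have h1 : HasSum (fun x : Site d => ∫ k : RSpace d, (spinCorrelation μ x : ℂ) *
      (Complex.exp (↑(-2 * Real.pi * ⟪k, sitePoint x⟫) * Complex.I) * φ k))
      (∫ k, ((4 * diffractionDensity μ k : ℝ) : ℂ) * φ k) := by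
    refine hasSum_integral_of_dominated_convergence
      (fun x k => |spinCorrelation μ x| * ‖φ k‖) (fun x => ?_) (fun x => ?_) ?_ ?_ ?_
    · refine Continuous.aestronglyMeasurable ?_
      have := φ.continuous
      fun_prop
    · refine ae_of_all _ fun k => ?_
      rw [norm_mul, norm_mul, Complex.norm_exp_ofReal_mul_I, one_mul, Complex.norm_real,
        Real.norm_eq_abs]
    · exact ae_of_all _ fun k => hc.abs.mul_right _
    · simp_rw [tsum_mul_right]
      exact (φ.integrable (μ := volume)).norm.const_mul _
    · refine ae_of_all _ fun k => ?_
      refine ((hasSum_spinCorrelation_mul_exp hshift hc k).mul_right (φ k)).congr_fun fun x => ?_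
      exact (mul_assoc _ _ _).symm
  have h2 : (∫ k, ((4 * diffractionDensity μ k : ℝ) : ℂ) * φ k) =
      4 * ∫ k, (diffractionDensity μ k : ℂ) * φ k := by
    rw [← integral_const_mul]
    refine integral_congr_ae (ae_of_all _ fun k => ?_)
    push_cast
    ring
  rw [h2] at h1
  refine h1.congr_fun fun x => ?_
  rw [integral_const_mul, Real.fourier_eq']
  rfl

lemma isFourierTransformOf_diffractionMeasure {d : ℕ} {μ : Measure (SpinConfig d)}
    [IsProbabilityMeasure μ] (hshift : ∀ a : Site d, μ.map (shift a) = μ)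
    (hflip : μ.map (fun σ x => -σ x) = μ) (hc : Summable (spinCorrelation μ)) :
    IsFourierTransformOf (correlationMeasure μ) (diffractionMeasure μ) := by
  have hg := continuous_diffractionDensity hc
  have hg0 := diffractionDensity_nonneg hshift hc
  have hcomb (φ : 𝓢(RSpace d, ℂ)) : Integrable φ (latticeComb d) := by
    rw [latticeComb_eq]
    exact integrable_sum_smul_dirac_sitePoint φ fun _ => le_rfl
  have hcomb' (φ : 𝓢(RSpace d, ℂ)) : Integrable φ ((1 / 4 : ℝ≥0∞) • latticeComb d) :=
    (hcomb φ).smul_measure (by simp)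
  have hac (φ : 𝓢(RSpace d, ℂ)) :
      Integrable φ (volume.withDensity fun k => ENNReal.ofReal (diffractionDensity μ k)) := by
    rw [integrable_withDensity_iff_integrable_smul' hg.measurable.ennreal_ofReal (by simp)]
    have h1 : Integrable (fun k => diffractionDensity μ k • φ k) :=
      (φ.integrable (μ := volume)).bdd_smul ((∑' x, |spinCorrelation μ x|) / 4)
        hg.aestronglyMeasurable (ae_of_all _ fun k => by
          rw [Real.norm_of_nonneg (hg0 k)]; exact diffractionDensity_le hc k)
    refine h1.congr (ae_of_all _ fun k => ?_)
    simp only [ENNReal.toReal_ofReal (hg0 k)]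
  have hdens (x : Site d) : densityCorrelation μ x = (1 + spinCorrelation μ x) / 4 :=
    densityCorrelation_eq hflip x
  have hdens1 (x : Site d) : 0 ≤ densityCorrelation μ x ∧ densityCorrelation μ x ≤ 1 := by
    have := abs_le.1 (abs_spinCorrelation_le μ x)
    rw [hdens]
    constructor <;> linarith [this.1, this.2]
  refine ⟨fun φ => integrable_sum_smul_dirac_sitePoint φ fun x => by
    simpa using (hdens1 x).2, fun φ => (hcomb' φ).add_measure (hac φ), fun φ => ?_⟩
  have hν : ∫ k, φ k ∂diffractionMeasure μ = (1 / 4) * ∑' k : Site d, φ (sitePoint k) +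
      ∫ k, (diffractionDensity μ k : ℂ) * φ k := by
    rw [diffractionMeasure, integral_add_measure (hcomb' φ) (hac φ), integral_smul_measure,
      latticeComb_eq, integral_sum_dirac (by simp),
      integral_withDensity_eq_integral_toReal_smul hg.measurable.ennreal_ofReal (by simp)]
    congr 1
    · simp
    · refine integral_congr_ae (ae_of_all _ fun k => ?_)
      simp only [ENNReal.toReal_ofReal (hg0 k), Complex.real_smul]
  have h1 := ((hasSum_fourier_sitePoint φ).add
    (hasSum_spinCorrelation_mul_fourier hshift hc φ)).mul_left (1 / 4 : ℂ)
  rw [hν, correlationMeasure, integral_sum_dirac fun _ => ENNReal.ofReal_ne_top]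
  have h2 : ∀ x : Site d, (ENNReal.ofReal (densityCorrelation μ x)).toReal •
      𝓕 (φ : RSpace d → ℂ) (sitePoint x) = (1 / 4 : ℂ) * (𝓕 (φ : RSpace d → ℂ) (sitePoint x) +
        (spinCorrelation μ x : ℂ) * 𝓕 (φ : RSpace d → ℂ) (sitePoint x)) := fun x => by
    rw [ENNReal.toReal_ofReal (hdens1 x).1, hdens, Complex.real_smul]
    push_cast
    ring
  rw [tsum_congr h2, h1.tsum_eq]
  ring

theorem mainTheorem3 (d : ℕ) (hd : 1 ≤ d)
    (J : Site d → ℝ) (hJsymm : ∀ x, J (-x) = J x) (hJsum : Summable fun x => |J x|)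
    (β : ℝ) (hβ : 0 < β)
    (μ : Measure (SpinConfig d)) (hμ : IsGibbsMeasure J β μ)
    (hunique : ∀ μ' : Measure (SpinConfig d), IsGibbsMeasure J β μ' → μ' = μ)
    (hdecay :
      (∃ C ε : ℝ, 0 < C ∧ 0 < ε ∧
        ∀ x : Site d, |spinCorrelation μ x| ≤ C * Real.exp (-ε * ‖sitePoint x‖)) ∨
      (∃ C p : ℝ, 0 < C ∧ (d : ℝ) < p ∧
        ∀ x : Site d, x ≠ 0 → |spinCorrelation μ x| ≤ C * ‖sitePoint x‖ ^ (-p))) :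
    ∃ ν : Measure (RSpace d),
      (∀ᵐ σ ∂μ, IsDiffractionSpectrum (particleMeasure σ) ν) ∧
      (∀ᵐ σ ∂μ, IsAutocorrelation (particleMeasure σ) (correlationMeasure μ)) ∧
      IsFourierTransformOf (correlationMeasure μ) ν ∧
      IsLatticePeriodic ν ∧
      ∃ g : RSpace d → ℝ, Continuous g ∧ (∀ k, 0 ≤ g k) ∧
        IsLebesgueDecomposition ν
          ((1 / 4 : ℝ≥0∞) • latticeComb d)
          (volume.withDensity fun k => ENNReal.ofReal (g k))
          0 := by
  have := hμ.isProbabilityMeasure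
  have hshift (a : Site d) : μ.map (shift a) = μ := hunique _ (hμ.map_shift hJsum a)
  have hflip : μ.map (fun σ x => -σ x) = μ := hunique _ (hμ.map_neg hJsum)
  have hc := summable_spinCorrelation hdecay
  have hauto := ae_isAutocorrelation hd hJsum hμ hunique
  have hfourier := isFourierTransformOf_diffractionMeasure hshift hflip hc
  exact ⟨diffractionMeasure μ, hauto.mono fun σ hσ => ⟨_, hσ, hfourier⟩, hauto, hfourier,
    isLatticePeriodic_diffractionMeasure hc, diffractionDensity μ, continuous_diffractionDensity hc,
    diffractionDensity_nonneg hshift hc, isLebesgueDecomposition_diffractionMeasure μ⟩
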